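/- Conventions. For a smooth map $\varphi:(M,g)\to(N,h)$ between Riemannian manifolds let $\tau(\varphi)=\mathrm{Trace}_g\nabla d\varphi$ be its tension field and $$\tau_2(\varphi)=\mathrm{Trace}_g\big(\nabla^{\varphi}\nabla^{\varphi}-\nabla^{\varphi}_{\nabla^{M}}\big)\tau(\varphi)-\mathrm{Trace}_g R^N(d\varphi,\tau(\varphi))\,d\varphi,\qquad R^N(X,Y)Z=[\nabla^N_X,\nabla^N_Y]Z-\nabla^N_{[X,Y]}Z,$$ its bitension field. The map $\varphi$ is harmonic if $\tau(\varphi)\equiv0$, biharmonic if $\tau_2(\varphi)\equiv 0$ (the Euler--Lagrange equation of the bienergy $\frac12\int|\tau(\varphi)|^2v_g$), and proper biharmonic if it is biharmonic and not harmonic. Let $S^n(r)\subset\mathbb R^{n+1}$ be the sphere of radius $r$ with the induced metric, and $S^n=S^n(1)$. Statement. Let $\Sigma\subset S^3$ be a sphere of radius $1/\sqrt2$: let $a\in\mathbb R^4$ be a unit vector, let $L:\mathbb R^3\to\mathbb R^4$ be a linear isometric embedding whose range is orthogonal to $a$, put $\varphi(u)=\frac1{\sqrt2}(Lu+a)$ for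 $u\in S^2$, and let $\Sigma=\varphi(S^2)$. Identify $S^2(1/\sqrt2)$ with $S^2$, endowed with the metric induced by $u\mapsto\frac{1}{\sqrt2}u\in\mathbb R^3$. Then: 1. $\varphi:S^2(1/\sqrt2)\to S^3$ is an injective isometric immersion with image $\Sigma=\{X\in S^3:\langle X,a\rangle=1/\sqrt2\}$. 2. $\varphi$ is proper biharmonic, and so is its restriction to every nonempty open subset of $S^2(1/\sqrt2)$. 3. In stereographic coordinates $\varphi$ is the map $$\left(\mathbb R^2,\ \frac{4(dx^2+dy^2)}{(2+x^2+y^2)^2}\right)\to\left(\mathbb R^3,\ \frac{4(dx^2+dy^2+dz^2)}{(1+x^2+y^2+z^2)^2}\right),\qquad (x,y)\mapsto(x,y,1).$$ Precisely, let $\sigma_n(x)=\frac{1}{1+|x|^2}(2x,|x|^2-1)$ be the inverse of the stereographic projection of $S^n$ from its north pole $N_n$. There is a linear isometry $T$ of $\mathbb R^4$ such that $P(x,y)=\sigma_2\big(\tfrac{1}{\sqrt2}(x,y)\big)$ is an injective isometric immersion of $\left(\mathbb R^2,\frac{4(dx^2+dy^2)}{(2+x^2+y^2)^2}\right)$ into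 $S^2(1/\sqrt2)$ with image the complement of $N_2$, $Q=T\circ\sigma_3$ is an injective isometric immersion of $\left(\mathbb R^3,\frac{4(dx^2+dy^2+dz^2)}{(1+x^2+y^2+z^2)^2}\right)$ into $S^3$ with image the complement of $TN_3$, and $\varphi(P(x,y))=Q(x,y,1)$ for all $(x,y)\in\mathbb R^2$. 4. The coordinate map $(x,y)\mapsto(x,y,1)$, with the two metrics in 3, is an isometric immersion, and its restriction to every nonempty open subset of $\mathbb R^2$ is proper biharmonic. -/

import Mathlib

open scoped Manifold ContDiff

noncomputable section

/-- Euclidean space `ℝⁿ`. -/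
abbrev Euc (n : ℕ) : Type := EuclideanSpace ℝ (Fin n)

/-- The unit sphere `Sⁿ` of `ℝⁿ⁺¹`, with Mathlib's smooth structure. -/
abbrev Sph (n : ℕ) : Type := Metric.sphere (0 : Euc (n + 1)) 1

/-- Smooth Riemannian metrics on an `m`-dimensional smooth manifold `M`. -/
abbrev Riem (m : ℕ) (M : Type*) [TopologicalSpace M] [ChartedSpace (Euc m) M]
    [IsManifold (𝓡 m) ∞ M] : Type _ :=
  Bundle.ContMDiffRiemannianMetric (𝓡 m) ∞ (Euc m) (fun p : M => TangentSpace (𝓡 m) p)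

/-! ### Tensor calculus in coordinates -/

/-- The partial derivative `∂ᵢ f`. -/
def pd {m : ℕ} (i : Fin m) (f : Euc m → ℝ) (x : Euc m) : ℝ :=
  fderiv ℝ f x (EuclideanSpace.single i 1)

/-- The Christoffel symbols
`Γᵏᵢⱼ = ½ ∑ₗ Gᵏˡ (∂ᵢ Gⱼₗ + ∂ⱼ Gᵢₗ - ∂ₗ Gᵢⱼ)` of the Levi-Civita connection of the metric with
coefficients `Gᵢⱼ`. -/
def christoffel {m : ℕ} (G : Euc m → Matrix (Fin m) (Fin m) ℝ) (k i j : Fin m) (x : Euc m) : ℝ :=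
  (1 / 2) * ∑ l, (G x)⁻¹ k l *
    (pd i (fun y => G y j l) x + pd j (fun y => G y i l) x - pd l (fun y => G y i j) x)

/-- The components of the curvature operator: the `d`-th component of `R(∂ₐ, ∂_b) ∂_c`, where
`R(X, Y) Z = ∇_X ∇_Y Z - ∇_Y ∇_X Z - ∇_[X,Y] Z`. -/
def curvatureCoeff {m : ℕ} (G : Euc m → Matrix (Fin m) (Fin m) ℝ) (d a b c : Fin m)
    (x : Euc m) : ℝ :=
  pd a (christoffel G d b c) x - pd b (christoffel G d a c) x +
    ∑ e, (christoffel G d a e x * christoffel G e b c x -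
      christoffel G d b e x * christoffel G e a c x)

/-- The covariant derivative `∇^ψ_{∂ᵢ} V` of a vector field `V` along `ψ : ℝᵐ → ℝⁿ`, for the
pullback of the Levi-Civita connection of the metric `H` on the target:
`(∇^ψ_{∂ᵢ} V)ᵃ = ∂ᵢ Vᵃ + ∑ Γᵃ_{bc}(ψ) ∂ᵢψᵇ Vᶜ`. -/
def covAlong {m n : ℕ} (H : Euc n → Matrix (Fin n) (Fin n) ℝ) (ψ : Euc m → Euc n)
    (i : Fin m) (V : Euc m → Fin n → ℝ) (x : Euc m) (a : Fin n) : ℝ :=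
  pd i (fun y => V y a) x +
    ∑ b, ∑ c, christoffel H a b c (ψ x) * pd i (fun y => ψ y b) x * V x c

/-- The tension field `τ(ψ) = Trace_G ∇dψ` in coordinates:
`τᵃ = ∑ Gⁱʲ ((∇^ψ_{∂ᵢ} ∂ⱼψ)ᵃ - ∑ₖ Γᵏᵢⱼ ∂ₖψᵃ)`. -/
def tensionCoord {m n : ℕ} (G : Euc m → Matrix (Fin m) (Fin m) ℝ)
    (H : Euc n → Matrix (Fin n) (Fin n) ℝ) (ψ : Euc m → Euc n) (x : Euc m) (a : Fin n) : ℝ :=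
  ∑ i, ∑ j, (G x)⁻¹ i j *
    (covAlong H ψ i (fun y b => pd j (fun z => ψ z b) y) x a -
      ∑ k, christoffel G k i j x * pd k (fun y => ψ y a) x)

/-- The bitension field
`τ₂(ψ) = Trace_G (∇^ψ ∇^ψ - ∇^ψ_{∇^M}) τ(ψ) - Trace_G R^N(dψ, τ(ψ)) dψ` in coordinates. -/
def bitensionCoord {m n : ℕ} (G : Euc m → Matrix (Fin m) (Fin m) ℝ)
    (H : Euc n → Matrix (Fin n) (Fin n) ℝ) (ψ : Euc m → Euc n) (x : Euc m) (a : Fin n) : ℝ :=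
  ∑ i, ∑ j, (G x)⁻¹ i j *
      (covAlong H ψ i (covAlong H ψ j (tensionCoord G H ψ)) x a -
        ∑ k, christoffel G k i j x * covAlong H ψ k (tensionCoord G H ψ) x a) -
    ∑ i, ∑ j, (G x)⁻¹ i j *
      ∑ b, ∑ c, ∑ d, curvatureCoeff H a b c d (ψ x) *
        pd i (fun y => ψ y b) x * tensionCoord G H ψ x c * pd j (fun y => ψ y d) x

/-! ### Harmonic and biharmonic maps between Riemannian manifolds -/

section Maps

variable {m n : ℕ} {M N : Type*}
  [TopologicalSpace M] [ChartedSpace (Euc m) M] [IsManifold (𝓡 m) ∞ M]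
  [TopologicalSpace N] [ChartedSpace (Euc n) N] [IsManifold (𝓡 n) ∞ N]

/-- The coefficients `g(∂ᵢ, ∂ⱼ)` of a Riemannian metric in the chart `e`. -/
def metricCoeff (g : Riem m M) (e : OpenPartialHomeomorph M (Euc m)) (x : Euc m) :
    Matrix (Fin m) (Fin m) ℝ :=
  Matrix.of fun i j => g.inner (e.symm x)
    (mfderiv (𝓡 m) (𝓡 m) e.symm x (EuclideanSpace.single i (1 : ℝ) : Euc m))
    (mfderiv (𝓡 m) (𝓡 m) e.symm x (EuclideanSpace.single j (1 : ℝ) : Euc m))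

/-- The map `φ` written in the preferred charts at `p` and at `φ p`. -/
def localRep (φ : M → N) (p : M) : Euc m → Euc n :=
  fun x => chartAt (Euc n) (φ p) (φ ((chartAt (Euc m) p).symm x))

/-- The components, in the preferred chart at `φ p`, of the tension field
`τ(φ) = Trace_g ∇dφ` at `p`. -/
def tension (g : Riem m M) (h : Riem n N) (φ : M → N) (p : M) : Fin n → ℝ :=
  tensionCoord (metricCoeff g (chartAt (Euc m) p)) (metricCoeff h (chartAt (Euc n) (φ p)))
    (localRep φ p) (chartAt (Euc m) p p)

/-- The components, in the preferred chart at `φ p`, of the bitension field `τ₂(φ)` at `p`. -/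
def bitension (g : Riem m M) (h : Riem n N) (φ : M → N) (p : M) : Fin n → ℝ :=
  bitensionCoord (metricCoeff g (chartAt (Euc m) p)) (metricCoeff h (chartAt (Euc n) (φ p)))
    (localRep φ p) (chartAt (Euc m) p p)

/-- `φ : (M, g) → (N, h)` is smooth and harmonic on the open set `U`. -/
def IsHarmonicOn (g : Riem m M) (h : Riem n N) (φ : M → N) (U : Set M) : Prop :=
  ContMDiffOn (𝓡 m) (𝓡 n) ∞ φ U ∧ ∀ p ∈ U, tension g h φ p = 0

/-- `φ : (M, g) → (N, h)` is smooth and biharmonic on the open set `U`. -/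
def IsBiharmonicOn (g : Riem m M) (h : Riem n N) (φ : M → N) (U : Set M) : Prop :=
  ContMDiffOn (𝓡 m) (𝓡 n) ∞ φ U ∧ ∀ p ∈ U, bitension g h φ p = 0

/-- Proper biharmonic: biharmonic but not harmonic. -/
def IsProperBiharmonicOn (g : Riem m M) (h : Riem n N) (φ : M → N) (U : Set M) : Prop :=
  IsBiharmonicOn g h φ U ∧ ¬ IsHarmonicOn g h φ U

/-- `φ : (M, g) → (N, h)` is an isometric immersion: it is smooth and `φ^* h = g`. -/
def IsIsometricImmersion (g : Riem m M) (h : Riem n N) (φ : M → N) : Prop :=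
  ContMDiff (𝓡 m) (𝓡 n) ∞ φ ∧
    ∀ (p : M) (u v : TangentSpace (𝓡 m) p),
      h.inner (φ p) (mfderiv (𝓡 m) (𝓡 n) φ p u) (mfderiv (𝓡 m) (𝓡 n) φ p v) = g.inner p u v

end Maps

/-! ### The metrics -/

theorem isVonNBounded_of_injective {m k : ℕ} (A : Euc m →L[ℝ] Euc k)
    (hA : Function.Injective A) :
    Bornology.IsVonNBounded ℝ {v : Euc m | inner ℝ (A v) (A v) < 1} := by
  obtain ⟨K, -, hK⟩ := (A : Euc m →ₗ[ℝ] Euc k).exists_antilipschitzWith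
    (LinearMap.ker_eq_bot.2 hA)
  refine (NormedSpace.isVonNBounded_closedBall ℝ (Euc m) K).subset fun v hv => ?_
  have h1 : ‖A v‖ ^ 2 < 1 := by
    rw [← real_inner_self_eq_norm_sq]
    exact hv
  have h2 : ‖A v‖ ≤ 1 := by nlinarith [norm_nonneg (A v)]
  have h3 := hK.le_mul_dist v 0
  rw [mem_closedBall_zero_iff]
  simp only [dist_zero_right, ContinuousLinearMap.coe_coe, map_zero] at h3
  exact h3.trans (mul_le_of_le_one_right K.2 h2)

section Metrics

variable {m : ℕ} {M : Type*} [TopologicalSpace M] [ChartedSpace (Euc m) M]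
  [IsManifold (𝓡 m) ∞ M]

/-- The bilinear form `(u, v) ↦ ⟪df(u), df(v)⟫` on the tangent space at `p`. -/
def pullbackForm {k : ℕ} (f : M → Euc k) (p : M) :
    TangentSpace (𝓡 m) p →L[ℝ] TangentSpace (𝓡 m) p →L[ℝ] ℝ :=
  ((mvfderiv (𝓡 m) f p).precomp ℝ).comp
    ((innerSL ℝ : Euc k →L[ℝ] Euc k →L[ℝ] ℝ).comp (mvfderiv (𝓡 m) f p))

/-- The metric induced on `M` by an immersion `f` into a Euclidean space. -/
def inducedMetric {k : ℕ} (f : M → Euc k) (hf : ContMDiff (𝓡 m) 𝓘(ℝ, Euc k) ∞ f)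
    (hinj : ∀ p, Function.Injective (mvfderiv (𝓡 m) f p)) : Riem m M where
  inner := pullbackForm f
  symm p v w := real_inner_comm (F := Euc k) _ _
  pos p v hv := by
    change 0 < inner ℝ (mvfderiv (𝓡 m) f p v) (mvfderiv (𝓡 m) f p v)
    exact real_inner_self_pos.2 fun h => hv (hinj p (h.trans (map_zero _).symm))
  isVonNBounded p := isVonNBounded_of_injective (mvfderiv (𝓡 m) f p) (hinj p)
  contMDiff := by
    intro p
    rw [contMDiffAt_hom_bundle]
    refine ⟨contMDiffAt_id, ?_⟩
    have h1 := (hf p).mfderiv_const (m := ∞) le_rfl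
    let B : (Euc m →L[ℝ] Euc k) → (Euc m →L[ℝ] Euc m →L[ℝ] ℝ) := fun D =>
      (innerSL ℝ : Euc k →L[ℝ] Euc k →L[ℝ] ℝ).bilinearComp D D
    have hB : ContDiff ℝ ∞ B := by
      have : B = fun D => ((ContinuousLinearMap.compL ℝ (Euc m) (Euc k) ℝ).flip D).comp
          ((innerSL ℝ : Euc k →L[ℝ] Euc k →L[ℝ] ℝ).comp D) := by
        ext D v w
        rfl
      rw [this]
      fun_prop
    have h2 := hB.contMDiff.contMDiffAt.comp p h1
    refine h2.congr_of_eventuallyEq ?_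
    filter_upwards [(chartAt (Euc m) p).open_source.mem_nhds (mem_chart_source _ p)] with x hx
    ext v w
    simp [B, ContinuousLinearMap.inCoordinates, inTangentCoordinates, mvfderiv, pullbackForm]
    rw [Bundle.Trivialization.linearMapAt_apply, if_pos]
    · simp [hom_trivializationAt_apply, ContinuousLinearMap.inCoordinates]
      rfl
    · simp
      exact hx

/-- The conformal change `w g` of the metric `g` by a smooth positive function `w`. -/
def conformalChange (w : M → ℝ) (hw : ContMDiff (𝓡 m) 𝓘(ℝ) ∞ w) (hpos : ∀ x, 0 < w x)
    (g : Riem m M) : Riem m M where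
  inner x := w x • g.inner x
  symm x u v := congrArg (w x * ·) (g.symm x u v)
  pos x v hv := mul_pos (hpos x) (g.pos x v hv)
  isVonNBounded x := by
    have := (g.isVonNBounded x).image
      (((Real.sqrt (w x))⁻¹) • ContinuousLinearMap.id ℝ (TangentSpace (𝓡 m) x))
    refine this.subset fun v hv => (Set.mem_image _ _ _).2 ⟨Real.sqrt (w x) • v, ?_, ?_⟩
    · have h : g.inner x (Real.sqrt (w x) • v) (Real.sqrt (w x) • v) = w x * g.inner x v v := by
        simp only [map_smul, FunLike.coe_smul, Pi.smul_apply, smul_eq_mul]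
        rw [← mul_assoc, Real.mul_self_sqrt (hpos x).le]
      exact h.trans_lt hv
    · simp [smul_smul, (Real.sqrt_pos.2 (hpos x)).ne']
  contMDiff := hw.smul_section g.contMDiff

end Metrics

/-- The flat metric `dx₁² + ⋯ + dxₙ²` on `ℝⁿ`. -/
def flatMetric (n : ℕ) : Riem n (Euc n) where
  inner := (riemannianMetricVectorSpace (Euc n)).inner
  symm := (riemannianMetricVectorSpace (Euc n)).symm
  pos := (riemannianMetricVectorSpace (Euc n)).pos
  isVonNBounded := (riemannianMetricVectorSpace (Euc n)).isVonNBounded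
  contMDiff := (riemannianMetricVectorSpace (Euc n)).contMDiff.of_le le_top

/-- The metric `4 (dx₁² + ⋯ + dxₙ²) / (c + |x|²)²` on `ℝⁿ`. -/
def stereoMetric (n : ℕ) (c : ℝ) (hc : 0 < c) : Riem n (Euc n) :=
  conformalChange (fun x => 4 / (c + ‖x‖ ^ 2) ^ 2)
    (ContDiff.contMDiff (contDiff_const.div ((contDiff_const.add (contDiff_norm_sq ℝ)).pow 2)
      fun x => by positivity))
    (fun x => by positivity) (flatMetric n)

/-- The round metric of the sphere `Sⁿ(r)` of radius `r`, carried to the unit sphere by `u ↦ r u`: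
the metric induced by `u ↦ r u ∈ ℝⁿ⁺¹`. Thus `(Sph n, sphereMetric n r)` is the Riemannian
manifold `Sⁿ(r)`. -/
def sphereMetric (n : ℕ) (r : ℝ) (hr : 0 < r) : Riem n (Sph n) :=
  inducedMetric (fun u : Sph n => r • (u : Euc (n + 1)))
    (by
      have : Fact (Module.finrank ℝ (Euc (n + 1)) = n + 1) := ⟨finrank_euclideanSpace_fin⟩
      exact (contDiff_const_smul (𝕜 := ℝ) (F := Euc (n + 1)) r).contMDiff.comp
        (contMDiff_coe_sphere (E := Euc (n + 1)) (n := n)))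
    (fun p => by
      have : Fact (Module.finrank ℝ (Euc (n + 1)) = n + 1) := ⟨finrank_euclideanSpace_fin⟩
      have h := injective_mvfderiv_subtypeVal_sphere (E := Euc (n + 1)) (n := n) p
      have hd : MDifferentiableAt (𝓡 n) 𝓘(ℝ, Euc (n + 1)) ((↑) : Sph n → Euc (n + 1)) p :=
        (contMDiff_coe_sphere (m := 1) p).mdifferentiableAt one_ne_zero
      have e := mvfderiv_fun_smul (a := fun _ : Sph n => r) mdifferentiableAt_const hd
      intro u v huv
      apply h
      have e' : ∀ w, mvfderiv (𝓡 n) (fun u : Sph n => r • (u : Euc (n + 1))) p w =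
          r • mvfderiv (𝓡 n) ((↑) : Sph n → Euc (n + 1)) p w := fun w => by
        have := congrArg (fun A => A w) e
        simpa [mvfderiv_const] using this
      rw [e', e'] at huv
      exact smul_right_injective _ hr.ne' huv)

/-! ### Spheres and stereographic coordinates -/

theorem inv_sqrt_two_pos : 0 < 1 / √(2 : ℝ) := by positivity

/-- Given a linear isometry `L : ℝ³ → ℝ⁴` and a unit vector `a` orthogonal to its range, the map
`u ↦ (L u + a) / √2` from `S²` to `S³`. Its image is the sphere of radius `1/√2` cut out of `S³`
by the hyperplane `⟪X, a⟫ = 1/√2`. -/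
def smallSphere (L : Euc 3 →ₗᵢ[ℝ] Euc 4) (a : Euc 4) (ha : ‖a‖ = 1)
    (hLa : ∀ v, inner ℝ (L v) a = 0) (u : Sph 2) : Sph 3 :=
  ⟨(1 / √(2 : ℝ)) • (L (u : Euc 3) + a), by
    have h : ‖L (u : Euc 3) + a‖ ^ 2 = 2 := by
      rw [norm_add_sq_real, hLa, L.norm_map, ha, norm_eq_of_mem_sphere u]
      norm_num
    have h' : ‖L (u : Euc 3) + a‖ = √2 := by
      rw [← h, Real.sqrt_sq (norm_nonneg _)]
    rw [mem_sphere_zero_iff_norm, norm_smul, h', Real.norm_of_nonneg inv_sqrt_two_pos.le]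
    field_simp⟩

/-- The north pole `(0, …, 0, 1)` of `Sⁿ`. -/
def northPole (n : ℕ) : Sph n :=
  ⟨EuclideanSpace.single (Fin.last n) 1, by simp⟩

/-- The inverse `x ↦ (2x, |x|² - 1) / (1 + |x|²)` of the stereographic projection of `Sⁿ` from the
north pole onto the equatorial hyperplane. -/
def stereoInv (n : ℕ) (x : Euc n) : Sph n :=
  ⟨WithLp.toLp 2 (Fin.snoc (α := fun _ => ℝ) (fun i => 2 * x i / (1 + ‖x‖ ^ 2))
      ((‖x‖ ^ 2 - 1) / (1 + ‖x‖ ^ 2))), by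
    rw [mem_sphere_zero_iff_norm, ← sq_eq_sq₀ (norm_nonneg _) zero_le_one,
      EuclideanSpace.real_norm_sq_eq, Fin.sum_univ_castSucc]
    have h : 1 + ‖x‖ ^ 2 ≠ 0 := by positivity
    simp only [Fin.snoc_castSucc, Fin.snoc_last, div_pow, mul_pow, ← Finset.sum_div,
      ← Finset.mul_sum, ← EuclideanSpace.real_norm_sq_eq]
    field_simp
    ring⟩

/-- The isometry of `Sⁿ` given by a linear isometry of `ℝⁿ⁺¹`. -/
def rotateSphere {n : ℕ} (T : Euc (n + 1) ≃ₗᵢ[ℝ] Euc (n + 1)) (u : Sph n) : Sph n :=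
  ⟨T (u : Euc (n + 1)), by simp [T.norm_map, norm_eq_of_mem_sphere u]⟩

/-- The map `(x, y) ↦ (x, y, 1)`. -/
def planeMap (x : Euc 2) : Euc 3 := !₂[x 0, x 1, 1]

end

/-! Biharmonicity comes from umbilicity with unit mean curvature. Suppose `∇dψ = G ⊗ η` with `η`
normal, the target has constant curvature 1, and `∇η = -dψ`. Then `τ = mη`, so `∇τ = -m dψ` and `∇²τ
= -m G ⊗ η`. On the other side `R(∂ᵢψ, τ)∂ⱼψ = ⟨τ, ∂ⱼψ⟩∂ᵢψ - Gᵢⱼτ = -m Gᵢⱼ η`. The two terms of `τ₂`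
cancel, while `τ = mη` vanishes nowhere. The radius `1/√2` enters through `∇η = -dψ`:
differentiating `⟨η, ∂ⱼψ⟩ = 0` gives `⟨∇ᵢη, ∂ⱼψ⟩ = -|η|² Gᵢⱼ`, so `η` must be a unit vector, and the
principal curvature of a small sphere of `S³` is 1 exactly at that radius.
`bitensionCoord_of_umbilic` is this argument in coordinates.

All metrics met here are conformally flat, `c |dx|² / (k + |x|²)²`, of curvature `4k/c`; their
Christoffel symbols and curvature are computed once. The umbilicity conditions then become algebraic
identities between Euclidean inner products.

The tension and bitension fields are defined through the preferred charts, which for the sphere are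
stereographic projections from `-p`. In these charts the small sphere becomes a Euclidean unit
sphere through the origin (`roundModel`, identified by `localRep_smallSphere`), and the source and
target metrics are `8|dx|²/(4+|x|²)²` and `16|dx|²/(4+|x|²)²`. The coordinate map `(x, y, 1)` is a
plane at distance 1 from the origin (`affineModel`). Both models are checked against the umbilicity
conditions.

The two pictures are linked by choosing the pole of `S³` on the small sphere, as the image of the
pole of `S²`: a sphere through the centre of projection projects to a plane. -/

open scoped Manifold ContDiff

noncomputable section

/-- The coefficients of the conformally flat metric `c |dx|² / (k + |x|²)²`. -/
def confCoeff (m : ℕ) (k c : ℝ) (x : Euc m) : Matrix (Fin m) (Fin m) ℝ :=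
  (c / (k + ‖x‖ ^ 2) ^ 2) • 1

/-- The Kronecker delta. -/
def kron {m : ℕ} (i j : Fin m) : ℝ := if i = j then 1 else 0

theorem kron_comm {m : ℕ} (i j : Fin m) : kron i j = kron j i := by
  simp only [kron, eq_comm]

theorem sum_kron_mul {m : ℕ} (i : Fin m) (f : Fin m → ℝ) : ∑ j, kron i j * f j = f i := by
  simp [kron]

theorem sum_kron_mul' {m : ℕ} (i : Fin m) (f : Fin m → ℝ) : ∑ j, kron j i * f j = f i := by
  simp [kron]

/-! ### Rules for partial derivatives. -/

section PartialDerivatives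

variable {m : ℕ} {i : Fin m} {x : Euc m} {f g : Euc m → ℝ}

theorem pd_eq_of_hasFDerivAt {f' : Euc m →L[ℝ] ℝ} (h : HasFDerivAt f f' x) :
    pd i f x = f' (EuclideanSpace.single i 1) := by
  rw [pd, h.fderiv]

theorem pd_add (hf : DifferentiableAt ℝ f x) (hg : DifferentiableAt ℝ g x) :
    pd i (fun y => f y + g y) x = pd i f x + pd i g x := by
  simp [pd, fderiv_fun_add hf hg]

theorem pd_sub (hf : DifferentiableAt ℝ f x) (hg : DifferentiableAt ℝ g x) :
    pd i (fun y => f y - g y) x = pd i f x - pd i g x := by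
  simp [pd, fderiv_fun_sub hf hg]

theorem pd_mul (hf : DifferentiableAt ℝ f x) (hg : DifferentiableAt ℝ g x) :
    pd i (fun y => f y * g y) x = f x * pd i g x + g x * pd i f x := by
  simp [pd, fderiv_fun_mul hf hg]

theorem pd_const (r : ℝ) : pd i (fun _ => r) x = 0 := by
  simp [pd]

theorem pd_const_mul (r : ℝ) (hf : DifferentiableAt ℝ f x) :
    pd i (fun y => r * f y) x = r * pd i f x := by
  rw [pd_mul (differentiableAt_const r) hf, pd_const, mul_zero, add_zero]

theorem pd_div (hf : DifferentiableAt ℝ f x) (hg : DifferentiableAt ℝ g x) (h0 : g x ≠ 0) :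
    pd i (fun y => f y / g y) x = (pd i f x * g x - f x * pd i g x) / g x ^ 2 := by
  have h := (hasDerivAt_inv h0).comp_hasFDerivAt x hg.hasFDerivAt
  have h' : pd i (fun y => (g y)⁻¹) x = -(g x ^ 2)⁻¹ * pd i g x := by
    rw [pd, show (fun y => (g y)⁻¹) = Inv.inv ∘ g from rfl, h.fderiv]
    simp [pd]
  simp only [div_eq_mul_inv]
  rw [pd_mul hf (hg.fun_inv h0), h']
  field_simp
  ring

theorem pd_pow (n : ℕ) (hf : DifferentiableAt ℝ f x) :
    pd i (fun y => f y ^ n) x = n * f x ^ (n - 1) * pd i f x := by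
  simp [pd, fderiv_fun_pow n hf]

theorem pd_coord (j : Fin m) : pd i (fun y => y j) x = kron j i := by
  refine (pd_eq_of_hasFDerivAt (EuclideanSpace.proj j : Euc m →L[ℝ] ℝ).hasFDerivAt).trans ?_
  simp [kron]

theorem pd_normSq : pd i (fun y => ‖y‖ ^ 2) x = 2 * x i := by
  rw [pd_eq_of_hasFDerivAt (hasStrictFDerivAt_norm_sq x).hasFDerivAt]
  simp [EuclideanSpace.inner_single_right]

theorem pd_clm {n : ℕ} (A : Euc m →L[ℝ] Euc n) (a : Fin n) :
    pd i (fun y => A y a) x = A (EuclideanSpace.single i 1) a := by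
  refine (pd_eq_of_hasFDerivAt
    ((EuclideanSpace.proj a : Euc n →L[ℝ] ℝ).comp A).hasFDerivAt).trans ?_
  simp

end PartialDerivatives

/-! ### Connection and curvature of the metrics `c |dx|² / (k + |x|²)²`. -/

section Conformal

variable {m : ℕ} {k c : ℝ}

theorem confCoeff_apply (x : Euc m) (i j : Fin m) :
    confCoeff m k c x i j = c / (k + ‖x‖ ^ 2) ^ 2 * kron i j := by
  simp [confCoeff, Matrix.one_apply, kron]

theorem confCoeff_inv_apply (hk : 0 < k) (hc : 0 < c) (x : Euc m) (i j : Fin m) :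
    (confCoeff m k c x)⁻¹ i j = (k + ‖x‖ ^ 2) ^ 2 / c * kron i j := by
  have h : (confCoeff m k c x)⁻¹ = ((k + ‖x‖ ^ 2) ^ 2 / c) • 1 := by
    apply Matrix.inv_eq_right_inv
    have : k + ‖x‖ ^ 2 ≠ 0 := by positivity
    rw [confCoeff, smul_mul_smul_comm, one_mul, div_mul_div_cancel₀ (by positivity),
      div_self hc.ne', one_smul]
  simp [h, Matrix.one_apply, kron]

theorem pd_confCoeff (hk : 0 < k) (x : Euc m) (l i j : Fin m) :
    pd l (fun y => confCoeff m k c y i j) x =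
      -(4 * c * x l / (k + ‖x‖ ^ 2) ^ 3) * kron i j := by
  have h : k + ‖x‖ ^ 2 ≠ 0 := by positivity
  have hn : DifferentiableAt ℝ (fun y : Euc m => ‖y‖ ^ 2) x :=
    (contDiff_norm_sq ℝ (n := 1)).differentiable one_ne_zero x
  simp only [confCoeff_apply]
  rw [pd_mul (by fun_prop (disch := positivity)) (by fun_prop), pd_const,
    pd_div (by fun_prop) (by fun_prop) (by positivity), pd_const, pd_pow _ (by fun_prop),
    pd_add (by fun_prop) (by fun_prop), pd_const, pd_normSq]
  field_simp
  push_cast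
  ring

/-- For a metric `e^{2u}|dx|²` the symbols are `∂ᵢu δⱼₗ + ∂ⱼu δᵢₗ - ∂ₗu δᵢⱼ`. Here `u = -log(k +
|x|²)` up to a constant, so `c` drops out. -/
theorem christoffel_confCoeff (hk : 0 < k) (hc : 0 < c) (x : Euc m) (l i j : Fin m) :
    christoffel (confCoeff m k c) l i j x =
      -2 / (k + ‖x‖ ^ 2) * (x i * kron j l + x j * kron i l - x l * kron i j) := by
  have h : k + ‖x‖ ^ 2 ≠ 0 := by positivity
  simp only [christoffel, pd_confCoeff hk, confCoeff_inv_apply hk hc, mul_assoc]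
  rw [← Finset.mul_sum, sum_kron_mul]
  field_simp
  ring

/-- Constant sectional curvature `4k/c`; the value is 1 exactly when `c = 4k`, the form required of
targets below. -/
theorem curvatureCoeff_confCoeff (hk : 0 < k) (hc : 0 < c) (x : Euc m) (d a b e : Fin m) :
    curvatureCoeff (confCoeff m k c) d a b e x =
      4 * k / c * (confCoeff m k c x b e * kron a d - confCoeff m k c x a e * kron b d) := by
  have h : k + ‖x‖ ^ 2 ≠ 0 := by positivity
  have hn : DifferentiableAt ℝ (fun y : Euc m => ‖y‖ ^ 2) x :=
    (contDiff_norm_sq ℝ (n := 1)).differentiable one_ne_zero x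
  have hp (l p i j : Fin m) : pd p (christoffel (confCoeff m k c) l i j) x =
      4 * x p / (k + ‖x‖ ^ 2) ^ 2 * (x i * kron j l + x j * kron i l - x l * kron i j) -
      2 / (k + ‖x‖ ^ 2) * (kron i p * kron j l + kron j p * kron i l - kron l p * kron i j) := by
    rw [show christoffel (confCoeff m k c) l i j = _ from
      funext fun y => christoffel_confCoeff hk hc y l i j]
    rw [pd_mul (by fun_prop (disch := positivity)) (by fun_prop),
      pd_div (by fun_prop) (by fun_prop) (by positivity), pd_const,
      pd_add (by fun_prop) (by fun_prop), pd_const, pd_normSq,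
      pd_sub (by fun_prop) (by fun_prop), pd_add (by fun_prop) (by fun_prop),
      pd_mul (by fun_prop) (by fun_prop), pd_mul (by fun_prop) (by fun_prop),
      pd_mul (by fun_prop) (by fun_prop), pd_const, pd_const, pd_const, pd_coord, pd_coord,
      pd_coord]
    field_simp
    ring
  -- The quadratic part `ΓΓ` of the curvature, for arbitrary `p`, `q`; the curvature is its
  -- antisymmetrization plus that of the derivative terms `hp`.
  have hs (p q : Fin m) : ∑ l, christoffel (confCoeff m k c) d p l x *
        christoffel (confCoeff m k c) l q e x =
      4 / (k + ‖x‖ ^ 2) ^ 2 * (x p * x q * kron e d + x p * x e * kron q d -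
        x p * x d * kron q e + 2 * (x q * x e * kron p d) - ‖x‖ ^ 2 * kron p d * kron q e -
        x d * x q * kron p e - x d * x e * kron p q + x d * x p * kron q e) := by
    have h1 : ∑ l, x l * x l = ‖x‖ ^ 2 := by
      rw [EuclideanSpace.real_norm_sq_eq]
      exact Finset.sum_congr rfl fun _ _ => (sq _).symm
    have h2 (l : Fin m) : christoffel (confCoeff m k c) d p l x *
        christoffel (confCoeff m k c) l q e x = 4 / (k + ‖x‖ ^ 2) ^ 2 *
        (kron l d * (x p * (x q * kron e l + x e * kron q l - x l * kron q e)) +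
          (kron e l * (x l * kron p d * x q) + kron q l * (x l * kron p d * x e) -
          x l * x l * (kron p d * kron q e)) -
          kron p l * (x d * (x q * kron e l + x e * kron q l - x l * kron q e))) := by
      rw [christoffel_confCoeff hk hc, christoffel_confCoeff hk hc]
      field_simp
      ring
    simp only [h2, ← Finset.mul_sum, Finset.sum_add_distrib, Finset.sum_sub_distrib, sum_kron_mul,
      sum_kron_mul', ← Finset.sum_mul, h1]
    rw [kron_comm e p, kron_comm q p]
    ring
  rw [curvatureCoeff, hp, hp, Finset.sum_sub_distrib, hs, hs, confCoeff_apply, confCoeff_apply,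
    kron_comm e a, kron_comm e b, kron_comm d a, kron_comm d b, kron_comm b a]
  field_simp
  ring

/-- Contracting the Kronecker deltas leaves only Euclidean inner products: `∇ᵢV = ∂ᵢV - 2/(k+|ψ|²)
(⟨ψ,∂ᵢψ⟩V + ⟨ψ,V⟩∂ᵢψ - ⟨∂ᵢψ,V⟩ψ)`. -/
theorem covAlong_confCoeff {n : ℕ} (hk : 0 < k) (hc : 0 < c) (ψ : Euc m → Euc n) (i : Fin m)
    (V : Euc m → Fin n → ℝ) (x : Euc m) (a : Fin n) :
    covAlong (confCoeff n k c) ψ i V x a = pd i (fun y => V y a) x - 2 / (k + ‖ψ x‖ ^ 2) *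
      ((∑ b, ψ x b * pd i (fun y => ψ y b) x) * V x a +
        (∑ b, ψ x b * V x b) * pd i (fun y => ψ y a) x -
        (∑ b, pd i (fun y => ψ y b) x * V x b) * ψ x a) := by
  rw [covAlong, sub_eq_add_neg, ← neg_mul]
  congr 1
  have h (b d : Fin n) : christoffel (confCoeff n k c) a b d (ψ x) * pd i (fun y => ψ y b) x *
      V x d = -(2 / (k + ‖ψ x‖ ^ 2)) *
        (kron d a * (V x d * (ψ x b * pd i (fun y => ψ y b) x)) +
        (ψ x d * V x d) * (kron b a * pd i (fun y => ψ y b) x) -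
        kron b d * (V x d * (pd i (fun y => ψ y b) x * ψ x a))) := by
    rw [christoffel_confCoeff hk hc]
    ring
  simp only [h, ← Finset.mul_sum, Finset.sum_add_distrib, Finset.sum_sub_distrib, sum_kron_mul,
      sum_kron_mul', ← Finset.sum_mul]
  congr 2
  · ring
  · simp only [Finset.sum_mul]
    exact Finset.sum_congr rfl fun b _ => by ring

end Conformal

/-! ### Tension and bitension fields of umbilical immersions. -/

section Umbilic

variable {m n : ℕ} {G : Euc m → Matrix (Fin m) (Fin m) ℝ} {H : Euc n → Matrix (Fin n) (Fin n) ℝ}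
  {ψ : Euc m → Euc n} {η : Euc m → Fin n → ℝ}

theorem covAlong_const_mul (r : ℝ) {V : Euc m → Fin n → ℝ}
    (hV : ∀ a, Differentiable ℝ fun y => V y a) (i : Fin m) (x : Euc m) (a : Fin n) :
    covAlong H ψ i (fun y b => r * V y b) x a = r * covAlong H ψ i V x a := by
  simp only [covAlong, pd_const_mul r (hV a x), mul_add, Finset.mul_sum]
  congr 1
  refine Finset.sum_congr rfl fun _ _ => Finset.sum_congr rfl fun _ _ => by ring

theorem differentiable_pd (hψ : ContDiff ℝ ∞ ψ) (j : Fin m) (b : Fin n) :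
    Differentiable ℝ fun y => pd j (fun z => ψ z b) y := by
  have h : ContDiff ℝ ∞ fun z => ψ z b := by fun_prop
  exact ((h.fderiv_right (m := 1) (by norm_cast)).clm_apply contDiff_const).differentiable
    one_ne_zero

theorem sum_inv_mul_self (hdet : ∀ x, IsUnit (G x).det) (hsymm : ∀ x, (G x).IsSymm) (x : Euc m) :
    ∑ i, ∑ j, (G x)⁻¹ i j * G x i j = m := by
  have h : ((G x)⁻¹ * G x).trace = m := by
    rw [Matrix.nonsing_inv_mul _ (hdet x), Matrix.trace_one, Fintype.card_fin]
  rw [← h, Matrix.trace]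
  refine Finset.sum_congr rfl fun i _ => ?_
  rw [Matrix.diag_apply, Matrix.mul_apply]
  exact Finset.sum_congr rfl fun j _ => by rw [(hsymm x).apply i j]

theorem tensionCoord_of_umbilic (hdet : ∀ x, IsUnit (G x).det) (hsymm : ∀ x, (G x).IsSymm)
    (hII : ∀ x i j a, covAlong H ψ i (fun y b => pd j (fun z => ψ z b) y) x a -
      ∑ k, christoffel G k i j x * pd k (fun y => ψ y a) x = G x i j * η x a) :
    tensionCoord G H ψ = fun x a => m * η x a := by
  funext x a
  simp only [tensionCoord, hII, ← mul_assoc, ← Finset.sum_mul, sum_inv_mul_self hdet hsymm]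

/-- A totally umbilical isometric immersion of unit normal curvature into a space of constant
curvature `1` is biharmonic. -/
theorem bitensionCoord_of_umbilic (hdet : ∀ x, IsUnit (G x).det) (hsymm : ∀ x, (G x).IsSymm)
    (hψ : ContDiff ℝ ∞ ψ) (hη : ∀ a, Differentiable ℝ fun y => η y a)
    (hII : ∀ x i j a, covAlong H ψ i (fun y b => pd j (fun z => ψ z b) y) x a -
      ∑ k, christoffel G k i j x * pd k (fun y => ψ y a) x = G x i j * η x a)
    (hshape : ∀ x i a, covAlong H ψ i η x a = -1 * pd i (fun y => ψ y a) x)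
    (hcurv : ∀ y d a b e, curvatureCoeff H d a b e y = H y b e * kron a d - H y a e * kron b d)
    (hiso : ∀ x i j, ∑ b, ∑ d, H (ψ x) b d * pd i (fun y => ψ y b) x * pd j (fun y => ψ y d) x =
      G x i j)
    (hnormal : ∀ x j, ∑ c, ∑ d, H (ψ x) c d * η x c * pd j (fun y => ψ y d) x = 0)
    (x : Euc m) (a : Fin n) : bitensionCoord G H ψ x a = 0 := by
  have hτ := tensionCoord_of_umbilic hdet hsymm hII
  have hd (j : Fin m) (b : Fin n) := differentiable_pd hψ j b
  have hcov (j : Fin m) : covAlong H ψ j (tensionCoord G H ψ) =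
      fun x a => (-m : ℝ) * pd j (fun y => ψ y a) x := by
    funext x a
    rw [hτ, covAlong_const_mul _ hη, hshape]
    ring
  -- Since `∇τ = -m dψ`, the second derivative of `τ` is `-m` times the second fundamental form.
  have h1 (i j : Fin m) : covAlong H ψ i (covAlong H ψ j (tensionCoord G H ψ)) x a -
      ∑ k, christoffel G k i j x * covAlong H ψ k (tensionCoord G H ψ) x a =
      G x i j * (-m * η x a) := by
    simp only [hcov]
    rw [covAlong_const_mul _ (hd j)]
    simp only [mul_left_comm _ (-m : ℝ), ← Finset.mul_sum, ← mul_sub, hII]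
  -- Constant curvature gives `⟨τ, ∂ⱼψ⟩∂ᵢψ - Gᵢⱼτ`, whose first term dies because `τ` is normal. The
  -- result equals `h1` entry by entry, so the cancellation precedes the trace.
  have h2 (i j : Fin m) : ∑ b, ∑ c, ∑ d, curvatureCoeff H a b c d (ψ x) *
        pd i (fun y => ψ y b) x * tensionCoord G H ψ x c * pd j (fun y => ψ y d) x =
      G x i j * (-m * η x a) := by
    have h3 (b c d : Fin n) : curvatureCoeff H a b c d (ψ x) *
        pd i (fun y => ψ y b) x * tensionCoord G H ψ x c * pd j (fun y => ψ y d) x =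
        m * (kron b a * (pd i (fun y => ψ y b) x *
          (H (ψ x) c d * η x c * pd j (fun y => ψ y d) x))) -
        m * (kron c a * (η x c *
          (H (ψ x) b d * pd i (fun y => ψ y b) x * pd j (fun y => ψ y d) x))) := by
      rw [hcurv, hτ]
      ring
    simp only [h3, Finset.sum_sub_distrib, ← Finset.mul_sum, hnormal, sum_kron_mul', mul_zero,
      Finset.sum_const_zero, hiso]
    ring
  simp only [bitensionCoord, h1, h2, sub_self]

end Umbilic

/-! ### Contractions with the conformally flat metrics. -/

section Spheres

variable {m n : ℕ}

theorem isUnit_det_confCoeff {k c : ℝ} (hk : 0 < k) (hc : 0 < c) (x : Euc m) :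
    IsUnit (confCoeff m k c x).det := by
  have : 0 < k + ‖x‖ ^ 2 := by positivity
  rw [confCoeff, Matrix.det_smul, Matrix.det_one, mul_one]
  exact (pow_pos (by positivity) _).ne'.isUnit

theorem isSymm_confCoeff (k c : ℝ) (x : Euc m) : (confCoeff m k c x).IsSymm := by
  rw [confCoeff, Matrix.IsSymm, Matrix.transpose_smul, Matrix.transpose_one]

theorem sum_mul_eq_inner (v w : Euc n) : ∑ b, v b * w b = inner ℝ v w := by
  simp [PiLp.inner_apply, mul_comm]

theorem sum_coord_mul_map (A : Euc m →ₗᵢ[ℝ] Euc n) (x : Euc m) (a : Fin n) :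
    ∑ k, x k * A (EuclideanSpace.single k 1) a = A x a := by
  conv_rhs => rw [← (EuclideanSpace.basisFun (Fin m) ℝ).sum_repr x]
  simp

theorem inner_single_single (i j : Fin m) :
    inner ℝ (EuclideanSpace.single i 1 : Euc m) (EuclideanSpace.single j 1) = kron i j := by
  simp [kron, EuclideanSpace.inner_single_left]

theorem sum_christoffel_confCoeff {k c : ℝ} (hk : 0 < k) (hc : 0 < c) (x : Euc m) (i j : Fin m)
    (f : Fin m → ℝ) : ∑ l, christoffel (confCoeff m k c) l i j x * f l =
      -2 / (k + ‖x‖ ^ 2) * (x i * f j + x j * f i - kron i j * ∑ l, x l * f l) := by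
  have h (l : Fin m) : christoffel (confCoeff m k c) l i j x * f l = -2 / (k + ‖x‖ ^ 2) *
      (x i * (kron j l * f l) + x j * (kron i l * f l) - kron i j * (x l * f l)) := by
    rw [christoffel_confCoeff hk hc]
    ring
  simp only [h, ← Finset.mul_sum, Finset.sum_add_distrib, Finset.sum_sub_distrib, sum_kron_mul]

theorem sum_confCoeff_mul {k c : ℝ} (y v w : Euc n) :
    ∑ b, ∑ d, confCoeff n k c y b d * v b * w d = c / (k + ‖y‖ ^ 2) ^ 2 * inner ℝ v w := by
  have h (b d : Fin n) : confCoeff n k c y b d * v b * w d =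
      c / (k + ‖y‖ ^ 2) ^ 2 * (v b * (kron b d * w d)) := by
    rw [confCoeff_apply]
    ring
  simp only [h, ← Finset.mul_sum, sum_kron_mul, sum_mul_eq_inner]

end Spheres

/-! ### The umbilicity conditions in Euclidean terms. -/

section ConformalUmbilic

variable {m n : ℕ} {k l c : ℝ} {ψ η : Euc m → Euc n} {D N : Fin m → Euc m → Euc n}
  {E : Fin m → Fin m → Euc m → Euc n}

/-- `D` and `E` stand for closed forms of the first and second partial derivatives of `ψ`, so that
for a concrete model only the algebraic identity `hII` is left to check. -/
theorem secondFundamentalForm_confCoeff (hk : 0 < k) (hl : 0 < l) (hc : 0 < c)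
    (hD : ∀ i x a, pd i (fun y => ψ y a) x = D i x a)
    (hE : ∀ i j x a, pd i (fun y => D j y a) x = E i j x a)
    (hII : ∀ i j x a, E i j x a - 2 / (k + ‖ψ x‖ ^ 2) * (inner ℝ (ψ x) (D i x) * D j x a +
        inner ℝ (ψ x) (D j x) * D i x a - inner ℝ (D i x) (D j x) * ψ x a) +
        2 / (l + ‖x‖ ^ 2) * (x i * D j x a + x j * D i x a - kron i j * ∑ p, x p * D p x a) =
      c / (l + ‖x‖ ^ 2) ^ 2 * kron i j * η x a) (x : Euc m) (i j : Fin m) (a : Fin n) :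
    covAlong (confCoeff n k (4 * k)) ψ i (fun y b => pd j (fun z => ψ z b) y) x a -
      ∑ p, christoffel (confCoeff m l c) p i j x * pd p (fun y => ψ y a) x =
      confCoeff m l c x i j * η x a := by
  simp only [covAlong_confCoeff hk (by positivity : 0 < 4 * k), hD, hE, sum_mul_eq_inner,
    sum_christoffel_confCoeff hl hc, confCoeff_apply, ← hII]
  ring

theorem tensionCoord_confCoeff (hk : 0 < k) (hl : 0 < l) (hc : 0 < c)
    (hD : ∀ i x a, pd i (fun y => ψ y a) x = D i x a)
    (hE : ∀ i j x a, pd i (fun y => D j y a) x = E i j x a)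
    (hII : ∀ i j x a, E i j x a - 2 / (k + ‖ψ x‖ ^ 2) * (inner ℝ (ψ x) (D i x) * D j x a +
        inner ℝ (ψ x) (D j x) * D i x a - inner ℝ (D i x) (D j x) * ψ x a) +
        2 / (l + ‖x‖ ^ 2) * (x i * D j x a + x j * D i x a - kron i j * ∑ p, x p * D p x a) =
      c / (l + ‖x‖ ^ 2) ^ 2 * kron i j * η x a) (x : Euc m) (a : Fin n) :
    tensionCoord (confCoeff m l c) (confCoeff n k (4 * k)) ψ x a = m * η x a := by
  rw [tensionCoord_of_umbilic (η := fun x a => η x a) (isUnit_det_confCoeff hl hc)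
    (isSymm_confCoeff l c) (secondFundamentalForm_confCoeff hk hl hc hD hE hII)]

/-- The target constant `4k` makes its curvature 1, while `l` and `c` leave the curvature of the
source free. `N` stands for the derivative of `η`. -/
theorem bitensionCoord_confCoeff (hk : 0 < k) (hl : 0 < l) (hc : 0 < c)
    (hψ : ContDiff ℝ ∞ ψ) (hη : Differentiable ℝ η)
    (hD : ∀ i x a, pd i (fun y => ψ y a) x = D i x a)
    (hE : ∀ i j x a, pd i (fun y => D j y a) x = E i j x a)
    (hN : ∀ i x a, pd i (fun y => η y a) x = N i x a)
    (hII : ∀ i j x a, E i j x a - 2 / (k + ‖ψ x‖ ^ 2) * (inner ℝ (ψ x) (D i x) * D j x a +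
        inner ℝ (ψ x) (D j x) * D i x a - inner ℝ (D i x) (D j x) * ψ x a) +
        2 / (l + ‖x‖ ^ 2) * (x i * D j x a + x j * D i x a - kron i j * ∑ p, x p * D p x a) =
      c / (l + ‖x‖ ^ 2) ^ 2 * kron i j * η x a)
    (hshape : ∀ i x a, N i x a - 2 / (k + ‖ψ x‖ ^ 2) * (inner ℝ (ψ x) (D i x) * η x a +
        inner ℝ (ψ x) (η x) * D i x a - inner ℝ (D i x) (η x) * ψ x a) = -D i x a)
    (hiso : ∀ i j x, 4 * k / (k + ‖ψ x‖ ^ 2) ^ 2 * inner ℝ (D i x) (D j x) =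
      c / (l + ‖x‖ ^ 2) ^ 2 * kron i j)
    (hnormal : ∀ j x, inner ℝ (η x) (D j x) = 0) (x : Euc m) (a : Fin n) :
    bitensionCoord (confCoeff m l c) (confCoeff n k (4 * k)) ψ x a = 0 := by
  have hk' : 0 < 4 * k := by positivity
  refine bitensionCoord_of_umbilic (η := fun x a => η x a) (isUnit_det_confCoeff hl hc)
    (isSymm_confCoeff l c) hψ (fun a => by fun_prop)
    (secondFundamentalForm_confCoeff hk hl hc hD hE hII) ?_ ?_ ?_ ?_ x a
  · intro x i a
    simp only [covAlong_confCoeff hk hk', hD, hN, sum_mul_eq_inner, hshape, neg_one_mul]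
  · intro y d a b e
    rw [curvatureCoeff_confCoeff hk hk', div_self hk'.ne', one_mul]
  · intro x i j
    simp only [hD, sum_confCoeff_mul, hiso]
    rw [confCoeff_apply]
  · intro x j
    simp only [hD, sum_confCoeff_mul, hnormal, mul_zero]

end ConformalUmbilic

/-! ### The plane and the round sphere as umbilical models. -/

section Models

variable {m n : ℕ} (A : Euc m →ₗᵢ[ℝ] Euc n) (ν : Euc n)

/-- The affine map `x ↦ A x + ν`. -/
def affineModel (x : Euc m) : Euc n := A x + ν

/-- The parametrization `x ↦ (4√2 A x + 2|x|² ν) / (8 + |x|²)`. -/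
def roundModel (x : Euc m) : Euc n :=
  (4 * √2 / (8 + ‖x‖ ^ 2)) • A x + (2 * ‖x‖ ^ 2 / (8 + ‖x‖ ^ 2)) • ν

variable {A ν}

theorem norm_sq_combination (hν : ‖ν‖ = 1) (hA : ∀ v, inner ℝ (A v) ν = 0) (p q : ℝ)
    (x : Euc m) : ‖p • A x + q • ν‖ ^ 2 = p ^ 2 * ‖x‖ ^ 2 + q ^ 2 := by
  rw [norm_add_sq_real, norm_smul, norm_smul, A.norm_map, hν, inner_smul_left, inner_smul_right,
    hA, mul_pow, mul_pow]
  simp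

theorem contDiff_affineModel : ContDiff ℝ ∞ (affineModel A ν) :=
  A.toContinuousLinearMap.contDiff.add contDiff_const

theorem contDiff_roundModel : ContDiff ℝ ∞ (roundModel A ν) := by
  have h (x : Euc m) : 8 + ‖x‖ ^ 2 ≠ 0 := by positivity
  have hn : ContDiff ℝ ∞ fun x : Euc m => ‖x‖ ^ 2 := contDiff_norm_sq ℝ
  have hA : ContDiff ℝ ∞ A := A.toContinuousLinearMap.contDiff
  unfold roundModel
  fun_prop (disch := exact h)

/-- On the image `1 + |X|² = 2 + |x|²`, so `η = ((2+|x|²)/2) ν` is the Euclidean normal `ν` rescaled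
to unit length for `4|dX|²/(1+|X|²)²`. -/
theorem affineModel_tension_bitension (hν : ‖ν‖ = 1) (hA : ∀ v, inner ℝ (A v) ν = 0) (x : Euc m)
    (a : Fin n) :
    tensionCoord (confCoeff m 2 4) (confCoeff n 1 4) (affineModel A ν) x a =
      m * (((2 + ‖x‖ ^ 2) / 2) • ν) a ∧
    bitensionCoord (confCoeff m 2 4) (confCoeff n 1 4) (affineModel A ν) x a = 0 := by
  have hA' : ∀ v, inner ℝ ν (A v) = 0 := fun v => by rw [real_inner_comm, hA]
  have hn : Differentiable ℝ fun y : Euc m => ‖y‖ ^ 2 :=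
    (contDiff_norm_sq ℝ (n := 1)).differentiable one_ne_zero
  have hsq (y : Euc m) : ‖affineModel A ν y‖ ^ 2 = ‖y‖ ^ 2 + 1 := by
    simpa [affineModel] using norm_sq_combination hν hA 1 1 y
  have hAd (b : Fin n) : Differentiable ℝ fun y => A y b :=
    ((EuclideanSpace.proj b : Euc n →L[ℝ] ℝ).comp A.toContinuousLinearMap).differentiable
  have hD (i : Fin m) (y : Euc m) (b : Fin n) : pd i (fun z => affineModel A ν z b) y =
      A (EuclideanSpace.single i 1) b := by
    simp only [affineModel, PiLp.add_apply]
    rw [pd_add (hAd b y) (by fun_prop), pd_const, add_zero]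
    exact pd_clm A.toContinuousLinearMap b
  have hE (i j : Fin m) (y : Euc m) (b : Fin n) :
      pd i (fun _ => A (EuclideanSpace.single j 1) b) y = (0 : Euc n) b := by
    rw [pd_const, PiLp.zero_apply]
  have h1 (i j : Fin m) : inner ℝ (A (EuclideanSpace.single i 1))
      (A (EuclideanSpace.single j 1)) = kron i j := by
    rw [A.inner_map_map, inner_single_single]
  have h2 (y : Euc m) (i : Fin m) :
      inner ℝ (affineModel A ν y) (A (EuclideanSpace.single i 1)) = y i := by
    simp [affineModel, inner_add_left, hA', EuclideanSpace.inner_single_right]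
  have hII (i j : Fin m) (y : Euc m) (b : Fin n) : (0 : Euc n) b - 2 / (1 + ‖affineModel A ν y‖ ^ 2) *
      (inner ℝ (affineModel A ν y) (A (EuclideanSpace.single i 1)) *
          A (EuclideanSpace.single j 1) b +
        inner ℝ (affineModel A ν y) (A (EuclideanSpace.single j 1)) *
          A (EuclideanSpace.single i 1) b -
        inner ℝ (A (EuclideanSpace.single i 1)) (A (EuclideanSpace.single j 1)) *
          affineModel A ν y b) +
        2 / (2 + ‖y‖ ^ 2) * (y i * A (EuclideanSpace.single j 1) b +
          y j * A (EuclideanSpace.single i 1) b -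
          kron i j * ∑ p, y p * A (EuclideanSpace.single p 1) b) =
      4 / (2 + ‖y‖ ^ 2) ^ 2 * kron i j * (((2 + ‖y‖ ^ 2) / 2) • ν) b := by
    have h : 2 + ‖y‖ ^ 2 ≠ 0 := by positivity
    rw [sum_coord_mul_map, h1, h2, h2, hsq, show 1 + (‖y‖ ^ 2 + 1) = 2 + ‖y‖ ^ 2 by ring]
    simp only [affineModel, PiLp.add_apply, PiLp.smul_apply, PiLp.zero_apply, smul_eq_mul]
    field_simp
    ring
  -- Exhibits the target in the form `c = 4k` with `k = 1`.
  rw [show confCoeff n 1 4 = confCoeff n 1 (4 * 1) by rw [mul_one]]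
  refine ⟨tensionCoord_confCoeff (D := fun i _ => A (EuclideanSpace.single i 1))
    (E := fun _ _ _ => 0) (η := fun y => ((2 + ‖y‖ ^ 2) / 2) • ν)
    one_pos two_pos four_pos hD hE hII x a,
    bitensionCoord_confCoeff (D := fun i _ => A (EuclideanSpace.single i 1))
    (E := fun _ _ _ => 0) (η := fun y => ((2 + ‖y‖ ^ 2) / 2) • ν) (N := fun i y => y i • ν)
    one_pos two_pos four_pos contDiff_affineModel (by fun_prop) hD hE ?_ hII ?_ ?_ ?_ x a⟩
  · intro i y b
    have hn := hn y
    simp only [PiLp.smul_apply, smul_eq_mul]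
    rw [pd_mul (by fun_prop) (by fun_prop), pd_div (by fun_prop) (by fun_prop) two_ne_zero,
      pd_add (by fun_prop) (by fun_prop), pd_const, pd_const, pd_normSq]
    ring
  · intro i y b
    have h : 2 + ‖y‖ ^ 2 ≠ 0 := by positivity
    have h3 : inner ℝ (affineModel A ν y) (((2 + ‖y‖ ^ 2) / 2) • ν) = (2 + ‖y‖ ^ 2) / 2 := by
      simp [affineModel, inner_add_left, inner_smul_right, hA, hν]
    rw [h2, h3, inner_smul_right, hA, hsq, show 1 + (‖y‖ ^ 2 + 1) = 2 + ‖y‖ ^ 2 by ring]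
    simp only [PiLp.smul_apply, smul_eq_mul]
    field_simp
    ring
  · intro i j y
    rw [h1, hsq, show 1 + (‖y‖ ^ 2 + 1) = 2 + ‖y‖ ^ 2 by ring]
    ring
  · intro j y
    rw [inner_smul_left, hA', mul_zero]

/-- The image lies on the Euclidean unit sphere centred at `ν`, which passes through the origin.
Everything is rational in the coordinates and `√2`, so after the derivatives and inner products are
in closed form, field arithmetic finishes. -/
theorem roundModel_tension_bitension (hν : ‖ν‖ = 1) (hA : ∀ v, inner ℝ (A v) ν = 0) (x : Euc m)
    (a : Fin n) :
    tensionCoord (confCoeff m 4 8) (confCoeff n 4 16) (roundModel A ν) x a =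
      m * ((2 * (4 + ‖x‖ ^ 2) / (8 + ‖x‖ ^ 2)) • (ν - roundModel A ν x)) a ∧
    bitensionCoord (confCoeff m 4 8) (confCoeff n 4 16) (roundModel A ν) x a = 0 := by
  have hA' : ∀ v, inner ℝ ν (A v) = 0 := fun v => by rw [real_inner_comm, hA]
  have hn : Differentiable ℝ fun y : Euc m => ‖y‖ ^ 2 :=
    (contDiff_norm_sq ℝ (n := 1)).differentiable one_ne_zero
  have h8 (y : Euc m) : 8 + ‖y‖ ^ 2 ≠ 0 := by positivity
  have h4 (y : Euc m) : 4 + ‖y‖ ^ 2 ≠ 0 := by positivity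
  have hr : √(2 : ℝ) ^ 2 = 2 := Real.sq_sqrt two_pos.le
  have hνν : inner ℝ ν ν = (1 : ℝ) := by rw [real_inner_self_eq_norm_sq, hν, one_pow]
  have hsq (y : Euc m) : ‖roundModel A ν y‖ ^ 2 = 4 * ‖y‖ ^ 2 / (8 + ‖y‖ ^ 2) := by
    have := h8 y
    rw [roundModel, norm_sq_combination hν hA, div_pow, mul_pow, hr]
    field_simp
    ring
  have hsq' (y : Euc m) : 4 + ‖roundModel A ν y‖ ^ 2 = 8 * (4 + ‖y‖ ^ 2) / (8 + ‖y‖ ^ 2) := by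
    have := h8 y
    rw [hsq]
    field_simp
    ring
  have hAd (b : Fin n) : Differentiable ℝ fun y => A y b :=
    ((EuclideanSpace.proj b : Euc n →L[ℝ] ℝ).comp A.toContinuousLinearMap).differentiable
  have hAp (i : Fin m) (y : Euc m) (b : Fin n) :
      pd i (fun z => A z b) y = A (EuclideanSpace.single i 1) b :=
    pd_clm A.toContinuousLinearMap b
  let D (i : Fin m) (y : Euc m) : Euc n :=
    (4 * √2 / (8 + ‖y‖ ^ 2)) • A (EuclideanSpace.single i 1) -
      (8 * √2 * y i / (8 + ‖y‖ ^ 2) ^ 2) • A y + (32 * y i / (8 + ‖y‖ ^ 2) ^ 2) • ν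
  let E (i j : Fin m) (y : Euc m) : Euc n :=
    (-(8 * √2 * y i / (8 + ‖y‖ ^ 2) ^ 2)) • A (EuclideanSpace.single j 1) -
      (8 * √2 * y j / (8 + ‖y‖ ^ 2) ^ 2) • A (EuclideanSpace.single i 1) +
      (32 * √2 * y i * y j / (8 + ‖y‖ ^ 2) ^ 3 - 8 * √2 * kron i j / (8 + ‖y‖ ^ 2) ^ 2) • A y +
      (32 * kron i j / (8 + ‖y‖ ^ 2) ^ 2 - 128 * y i * y j / (8 + ‖y‖ ^ 2) ^ 3) • ν
  -- `ν - ψ` has Euclidean length 1, and the factor is `(4 + |ψ|²)/4`, which makes it a unit vector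
  -- for `16|dX|²/(4+|X|²)²`.
  let η (y : Euc m) : Euc n := (2 * (4 + ‖y‖ ^ 2) / (8 + ‖y‖ ^ 2)) • (ν - roundModel A ν y)
  let N (i : Fin m) (y : Euc m) : Euc n := (16 * y i / (8 + ‖y‖ ^ 2) ^ 2) • (ν - roundModel A ν y) -
    (2 * (4 + ‖y‖ ^ 2) / (8 + ‖y‖ ^ 2)) • D i y
  have hD (i : Fin m) (y : Euc m) (b : Fin n) :
      pd i (fun z => roundModel A ν z b) y = D i y b := by
    have := h8 y
    have hn := hn y
    have hAd := hAd b y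
    simp only [roundModel, D, PiLp.add_apply, PiLp.sub_apply, PiLp.smul_apply, smul_eq_mul]
    rw [pd_add (by fun_prop (disch := exact this)) (by fun_prop (disch := exact this)),
      pd_mul (by fun_prop (disch := exact this)) (by fun_prop),
      pd_mul (by fun_prop (disch := exact this)) (by fun_prop),
      pd_div (by fun_prop) (by fun_prop) this, pd_div (by fun_prop) (by fun_prop) this,
      pd_add (by fun_prop) (by fun_prop), pd_const, pd_const, pd_const,
      pd_const_mul _ (by fun_prop), pd_normSq, hAp]
    field_simp
    ring
  have hE (i j : Fin m) (y : Euc m) (b : Fin n) :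
      pd i (fun z => D j z b) y = E i j y b := by
    have := h8 y
    have hn := hn y
    have hAd := hAd b y
    simp only [E, D, PiLp.add_apply, PiLp.sub_apply, PiLp.smul_apply, smul_eq_mul]
    have h2 : (8 + ‖y‖ ^ 2) ^ 2 ≠ 0 := by positivity
    have hp : pd i (fun z => (8 + ‖z‖ ^ 2) ^ 2) y = 4 * y i * (8 + ‖y‖ ^ 2) := by
      rw [pd_pow _ (by fun_prop), pd_add (by fun_prop) (by fun_prop), pd_const, pd_normSq]
      push_cast
      ring
    rw [pd_add (by fun_prop (disch := assumption)) (by fun_prop (disch := assumption)),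
      pd_sub (by fun_prop (disch := assumption)) (by fun_prop (disch := assumption)),
      pd_mul (by fun_prop (disch := assumption)) (by fun_prop),
      pd_mul (by fun_prop (disch := assumption)) (by fun_prop),
      pd_mul (by fun_prop (disch := assumption)) (by fun_prop),
      pd_div (by fun_prop) (by fun_prop) this, pd_div (by fun_prop) (by fun_prop) h2,
      pd_div (by fun_prop) (by fun_prop) h2, hp,
      pd_const_mul (8 * √2) (by fun_prop), pd_const_mul 32 (by fun_prop),
      pd_add (by fun_prop) (by fun_prop), pd_const, pd_const, pd_const, pd_const, pd_coord,
      pd_normSq, hAp, kron_comm j i]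
    field_simp
    ring
  have hN (i : Fin m) (y : Euc m) (b : Fin n) : pd i (fun z => η z b) y = N i y b := by
    have := h8 y
    have hd : DifferentiableAt ℝ (fun z => roundModel A ν z b) y :=
      (by have := contDiff_roundModel (A := A) (ν := ν); fun_prop :
        ContDiff ℝ ∞ fun z => roundModel A ν z b).differentiable (by simp) y
    have hn := hn y
    have hAd := hAd b y
    simp only [η, N, PiLp.sub_apply, PiLp.smul_apply, smul_eq_mul]
    rw [pd_mul (by fun_prop (disch := assumption)) (by fun_prop),
      pd_div (by fun_prop) (by fun_prop) this, pd_const_mul _ (by fun_prop),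
      pd_add (by fun_prop) (by fun_prop), pd_add (by fun_prop) (by fun_prop),
      pd_sub (by fun_prop) hd, pd_const, pd_const, pd_const, pd_normSq, hD]
    field_simp
    ring
  have hDD (i j : Fin m) (y : Euc m) :
      inner ℝ (D i y) (D j y) = 32 / (8 + ‖y‖ ^ 2) ^ 2 * kron i j := by
    have := h8 y
    simp only [D, inner_add_left, inner_sub_left, inner_add_right, inner_sub_right,
      inner_smul_left, inner_smul_right, A.inner_map_map, hA, hA', hνν, inner_single_single,
      real_inner_self_eq_norm_sq]
    simp only [EuclideanSpace.inner_single_left, EuclideanSpace.inner_single_right, conj_trivial]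
    field_simp
    ring_nf
    simp only [hr]
    ring
  have hψD (i : Fin m) (y : Euc m) :
      inner ℝ (roundModel A ν y) (D i y) = 32 * y i / (8 + ‖y‖ ^ 2) ^ 2 := by
    have := h8 y
    simp only [D, roundModel, inner_add_left, inner_add_right, inner_sub_right,
      inner_smul_left, inner_smul_right, A.inner_map_map, hA, hA', hνν,
      real_inner_self_eq_norm_sq, EuclideanSpace.inner_single_right]
    simp
    field_simp
    ring_nf
    simp only [hr]
    ring
  have hνD (i : Fin m) (y : Euc m) :
      inner ℝ ν (D i y) = 32 * y i / (8 + ‖y‖ ^ 2) ^ 2 := by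
    simp only [D, inner_add_right, inner_sub_right, inner_smul_right, hA', hνν]
    ring
  -- Normality reflects `|ψ - ν| = 1`: `ψ` and `ν` have equal products with `Dᵢ`.
  have hηD (i : Fin m) (y : Euc m) : inner ℝ (η y) (D i y) = 0 := by
    simp only [η]
    rw [inner_smul_left, inner_sub_left, hψD, hνD, sub_self, mul_zero]
  have hψη (y : Euc m) : inner ℝ (roundModel A ν y) (η y) =
      -(4 * ‖y‖ ^ 2 * (4 + ‖y‖ ^ 2)) / (8 + ‖y‖ ^ 2) ^ 2 := by
    have := h8 y
    have h : inner ℝ (roundModel A ν y) ν = 2 * ‖y‖ ^ 2 / (8 + ‖y‖ ^ 2) := by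
      simp only [roundModel, inner_add_left, inner_smul_left, hA, hνν]
      simp
    simp only [η]
    rw [inner_smul_right, inner_sub_right, h, real_inner_self_eq_norm_sq, hsq]
    field_simp
    ring
  have hxD (y : Euc m) (b : Fin n) : ∑ p, y p * D p y b =
      (4 * √2 / (8 + ‖y‖ ^ 2) - 8 * √2 * ‖y‖ ^ 2 / (8 + ‖y‖ ^ 2) ^ 2) * A y b +
        32 * ‖y‖ ^ 2 / (8 + ‖y‖ ^ 2) ^ 2 * ν b := by
    have h (p : Fin m) : y p * D p y b =
        4 * √2 / (8 + ‖y‖ ^ 2) * (y p * A (EuclideanSpace.single p 1) b) +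
        (y p * y p) * (32 / (8 + ‖y‖ ^ 2) ^ 2 * ν b - 8 * √2 / (8 + ‖y‖ ^ 2) ^ 2 * A y b) := by
      simp only [D, PiLp.add_apply, PiLp.sub_apply, PiLp.smul_apply, smul_eq_mul]
      ring
    simp only [h, Finset.sum_add_distrib, ← Finset.mul_sum, ← Finset.sum_mul, sum_coord_mul_map,
      sum_mul_eq_inner, real_inner_self_eq_norm_sq]
    ring
  have hII (i j : Fin m) (y : Euc m) (b : Fin n) :
      E i j y b - 2 / (4 + ‖roundModel A ν y‖ ^ 2) * (inner ℝ (roundModel A ν y) (D i y) * D j y b +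
        inner ℝ (roundModel A ν y) (D j y) * D i y b -
        inner ℝ (D i y) (D j y) * roundModel A ν y b) +
        2 / (4 + ‖y‖ ^ 2) * (y i * D j y b + y j * D i y b - kron i j * ∑ p, y p * D p y b) =
      8 / (4 + ‖y‖ ^ 2) ^ 2 * kron i j * η y b := by
    have h8 := h8 y
    have h4 := h4 y
    rw [hxD, hψD, hψD, hDD, hsq']
    simp only [η, E, D, roundModel, PiLp.add_apply, PiLp.sub_apply, PiLp.smul_apply, smul_eq_mul]
    field_simp
    ring
  rw [show confCoeff n 4 16 = confCoeff n 4 (4 * 4) by norm_num]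
  refine ⟨tensionCoord_confCoeff (η := η) four_pos four_pos (by norm_num) hD hE hII x a,
    bitensionCoord_confCoeff (η := η) four_pos four_pos (by norm_num)
      contDiff_roundModel ?_ hD hE hN hII ?_ ?_ (fun j y => hηD j y) x a⟩
  · have := (contDiff_roundModel (A := A) (ν := ν)).differentiable (by simp)
    simp only [η, div_eq_mul_inv]
    exact (((hn.const_add 4).const_mul 2).mul ((hn.const_add 8).inv h8)).smul (this.const_sub ν)
  · intro i y b
    have h8 := h8 y
    have h4 := h4 y
    rw [hψD, hψη, real_inner_comm, hηD, hsq']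
    simp only [η, N, PiLp.sub_apply, PiLp.smul_apply, smul_eq_mul]
    field_simp
    ring
  · intro i j y
    have h8 := h8 y
    have h4 := h4 y
    rw [hDD, hsq']
    field_simp
    ring

end Models

/-! ### Stereographic parametrizations of arbitrary scale. -/

section StereographicParametrization

variable {m n : ℕ}

theorem fact_finrank_euc (n : ℕ) : Fact (Module.finrank ℝ (Euc (n + 1)) = n + 1) :=
  ⟨finrank_euclideanSpace_fin⟩

/-- The stereographic parametrization
`x ↦ (2b J x + (|x|² - b²) N) / (b² + |x|²)` of a sphere, with pole `N` and scale `b`. -/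
def stereoParam (b : ℝ) (J : Euc m →ₗᵢ[ℝ] Euc n) (N : Euc n) (x : Euc m) : Euc n :=
  (b ^ 2 + ‖x‖ ^ 2)⁻¹ • ((2 * b) • J x + (‖x‖ ^ 2 - b ^ 2) • N)

variable {b : ℝ} {J : Euc m →ₗᵢ[ℝ] Euc n} {N : Euc n}

theorem contDiff_stereoParam (hb : 0 < b) : ContDiff ℝ ∞ (stereoParam b J N) := by
  have hn : ContDiff ℝ ∞ fun x : Euc m => ‖x‖ ^ 2 := contDiff_norm_sq ℝ
  have hJ : ContDiff ℝ ∞ J := J.toContinuousLinearMap.contDiff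
  have h (x : Euc m) : b ^ 2 + ‖x‖ ^ 2 ≠ 0 := by positivity
  unfold stereoParam
  fun_prop (disch := exact h)

theorem fderiv_stereoParam (hb : 0 < b) (x v : Euc m) :
    fderiv ℝ (stereoParam b J N) x v =
      (b ^ 2 + ‖x‖ ^ 2)⁻¹ • ((2 * b) • J v + (2 * inner ℝ x v) • N) -
      (2 * inner ℝ x v * ((b ^ 2 + ‖x‖ ^ 2) ^ 2)⁻¹) •
        ((2 * b) • J x + (‖x‖ ^ 2 - b ^ 2) • N) := by
  have h : b ^ 2 + ‖x‖ ^ 2 ≠ 0 := by positivity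
  have hn := (hasStrictFDerivAt_norm_sq x).hasFDerivAt
  have h1 := (hasDerivAt_inv h).comp_hasFDerivAt x (hn.const_add (b ^ 2))
  have h2 := (J.toContinuousLinearMap.hasFDerivAt (x := x)).const_smul (2 * b)
  have h3 := (hn.sub_const (b ^ 2)).smul_const N
  have h4 := h1.smul (h2.add h3)
  have h5 : fderiv ℝ (stereoParam b J N) x = _ := h4.fderiv
  rw [h5]
  simp
  module

/-- Needed for two scales: `b = 2` for the preferred charts of the sphere and `b = 1` for
`stereoInv`. -/
theorem inner_fderiv_stereoParam (hb : 0 < b) (hN : ‖N‖ = 1) (hJ : ∀ v, inner ℝ (J v) N = 0)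
    (x u v : Euc m) :
    inner ℝ (fderiv ℝ (stereoParam b J N) x u) (fderiv ℝ (stereoParam b J N) x v) =
      4 * b ^ 2 / (b ^ 2 + ‖x‖ ^ 2) ^ 2 * inner ℝ u v := by
  have h : b ^ 2 + ‖x‖ ^ 2 ≠ 0 := by positivity
  have hJ' : ∀ v, inner ℝ N (J v) = 0 := fun v => by rw [real_inner_comm, hJ]
  have hNN : inner ℝ N N = (1 : ℝ) := by rw [real_inner_self_eq_norm_sq, hN, one_pow]
  rw [fderiv_stereoParam hb, fderiv_stereoParam hb]
  simp only [inner_add_left, inner_sub_left, inner_add_right, inner_sub_right,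
      inner_smul_left, inner_smul_right, J.inner_map_map, hJ, hJ', hNN,
      real_inner_self_eq_norm_sq, conj_trivial]
  rw [real_inner_comm x u]
  field_simp
  ring

end StereographicParametrization

/-! ### The round metric and its coefficients in the preferred charts. -/

section SphereMetric

variable {m n : ℕ} {M : Type*} [TopologicalSpace M] [ChartedSpace (Euc m) M]

theorem mdifferentiableAt_coe_sphere (p : Sph n) :
    MDifferentiableAt (𝓡 n) 𝓘(ℝ, Euc (n + 1)) ((↑) : Sph n → Euc (n + 1)) p :=
  have := fact_finrank_euc n
  (contMDiff_coe_sphere (m := 1) p).mdifferentiableAt one_ne_zero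

theorem sphereMetric_inner (r : ℝ) (hr : 0 < r) (p : Sph n) (u v : TangentSpace (𝓡 n) p) :
    (sphereMetric n r hr).inner p u v =
      r ^ 2 * inner ℝ (mvfderiv (𝓡 n) ((↑) : Sph n → Euc (n + 1)) p u)
        (mvfderiv (𝓡 n) ((↑) : Sph n → Euc (n + 1)) p v) := by
  have e := mvfderiv_fun_smul (a := fun _ : Sph n => r) mdifferentiableAt_const
    (mdifferentiableAt_coe_sphere p)
  have e' : ∀ w, mvfderiv (𝓡 n) (fun u : Sph n => r • (u : Euc (n + 1))) p w =
      r • mvfderiv (𝓡 n) ((↑) : Sph n → Euc (n + 1)) p w := fun w => by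
    have := congrArg (fun A => A w) e
    simpa [mvfderiv_const] using this
  change inner ℝ (mvfderiv (𝓡 n) (fun u : Sph n => r • (u : Euc (n + 1))) p u)
    (mvfderiv (𝓡 n) (fun u : Sph n => r • (u : Euc (n + 1))) p v) = _
  rw [e', e', inner_smul_left, inner_smul_right, conj_trivial, ← mul_assoc, ← sq]

/-- Reduces the metric on image vectors to ambient Euclidean derivatives, by the chain rule for the
inclusion of the sphere. -/
theorem sphereMetric_inner_mfderiv (r : ℝ) (hr : 0 < r) {f : M → Sph n} {p : M}
    (hf : MDifferentiableAt (𝓡 m) (𝓡 n) f p) (u v : TangentSpace (𝓡 m) p) :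
    (sphereMetric n r hr).inner (f p) (mfderiv (𝓡 m) (𝓡 n) f p u) (mfderiv (𝓡 m) (𝓡 n) f p v) =
      r ^ 2 * inner ℝ (mvfderiv (𝓡 m) (fun q => (f q : Euc (n + 1))) p u)
        (mvfderiv (𝓡 m) (fun q => (f q : Euc (n + 1))) p v) := by
  have h (w : TangentSpace (𝓡 m) p) : mvfderiv (𝓡 m) (fun q => (f q : Euc (n + 1))) p w =
      mvfderiv (𝓡 n) ((↑) : Sph n → Euc (n + 1)) (f p) (mfderiv (𝓡 m) (𝓡 n) f p w) :=
    mfderiv_comp_apply p (mdifferentiableAt_coe_sphere (f p)) hf w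
  rw [sphereMetric_inner, h, h]

theorem sphereMetric_inner_mfderiv_euc (r : ℝ) (hr : 0 < r) {f : Euc m → Sph n} {x : Euc m}
    (hf : MDifferentiableAt (𝓡 m) (𝓡 n) f x) (u v : Euc m) :
    (sphereMetric n r hr).inner (f x) (mfderiv (𝓡 m) (𝓡 n) f x u) (mfderiv (𝓡 m) (𝓡 n) f x v) =
      r ^ 2 * inner ℝ (fderiv ℝ (fun q => (f q : Euc (n + 1))) x u)
        (fderiv ℝ (fun q => (f q : Euc (n + 1))) x v) := by
  have h (w : Euc m) : mvfderiv (𝓡 m) (fun q => (f q : Euc (n + 1))) x w =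
      fderiv ℝ (fun q => (f q : Euc (n + 1))) x w := by
    rw [← mfderiv_eq_fderiv]
    rfl
  exact (sphereMetric_inner_mfderiv r hr hf u v).trans (by rw [h, h])

/-- The preferred chart at `p` is stereographic projection from `-p`, read in some orthonormal basis
of `p^⊥`. `J` is the isometry given by that basis; since the basis is arbitrary, only isometry and
range are recorded. The last clause describes the chart itself by its products with test vectors. -/
theorem exists_chart_formula (p : Sph n) : ∃ J : Euc n →ₗᵢ[ℝ] Euc (n + 1),
    (∀ v, inner ℝ (J v) (p : Euc (n + 1)) = 0) ∧
    (∀ w, inner ℝ w (p : Euc (n + 1)) = 0 → ∃ v, J v = w) ∧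
    (∀ x, ((chartAt (Euc n) p).symm x : Euc (n + 1)) = stereoParam 2 J (-p) x) ∧
    ∀ (X : Sph n) (v : Euc n), inner ℝ (chartAt (Euc n) p X) v =
      2 / (1 + inner ℝ (p : Euc (n + 1)) X) * inner ℝ (X : Euc (n + 1)) (J v) := by
  have := fact_finrank_euc n
  let U := (OrthonormalBasis.fromOrthogonalSpanSingleton (𝕜 := ℝ) n
    (ne_zero_of_mem_unit_sphere (-p))).repr
  let J : Euc n →ₗᵢ[ℝ] Euc (n + 1) := (Submodule.subtypeₗᵢ _).comp U.symm.toLinearIsometry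
  have hJ (v : Euc n) : J v = (U.symm v : Euc (n + 1)) := rfl
  refine ⟨J, fun v => ?_, fun w hw => ?_, fun x => ?_, fun X v => ?_⟩
  · have h := Submodule.mem_orthogonal_singleton_iff_inner_left.1 (U.symm v).2
    simpa [hJ] using h
  · refine ⟨U ⟨w, Submodule.mem_orthogonal_singleton_iff_inner_left.2 (by simpa using hw)⟩, ?_⟩
    rw [hJ, U.symm_apply_apply]
  · refine (stereographic'_symm_apply (-p) x).trans ?_
    have h : ‖(U.symm x : Euc (n + 1))‖ = ‖x‖ := by
      rw [← hJ, J.norm_map]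
    simp only [stereoParam, hJ]
    change (‖(U.symm x : Euc (n + 1))‖ ^ 2 + 4)⁻¹ • (4 : ℝ) • (U.symm x : Euc (n + 1)) +
        (‖(U.symm x : Euc (n + 1))‖ ^ 2 + 4)⁻¹ •
          (‖(U.symm x : Euc (n + 1))‖ ^ 2 - 4) • (-p : Euc (n + 1)) = _
    rw [h, smul_add, show (2 : ℝ) ^ 2 = 4 by norm_num, show (2 : ℝ) * 2 = 4 by norm_num,
      add_comm (4 : ℝ)]
  · change inner ℝ (U (stereographic (norm_eq_of_mem_sphere (-p)) X)) v = _
    rw [← U.symm.inner_map_map, U.symm_apply_apply, stereographic_apply, inner_smul_left, hJ,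
      conj_trivial]
    congr 1
    · simp
    · exact Submodule.inner_orthogonalProjectionOnto_eq_of_mem_right (U.symm v) (X : Euc (n + 1))

theorem metricCoeff_sphereMetric (r : ℝ) (hr : 0 < r) (p : Sph n) :
    metricCoeff (sphereMetric n r hr) (chartAt (Euc n) p) = confCoeff n 4 (16 * r ^ 2) := by
  obtain ⟨J, hJ, -, hsymm, -⟩ := exists_chart_formula p
  funext x
  ext i j
  -- The chart is onto, so its inverse is smooth at every `x` and the coefficients are known on the
  -- whole space.
  have ht : (chartAt (Euc n) p).target = Set.univ :=
    have := fact_finrank_euc n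
    stereographic'_target (-p)
  have hd : MDifferentiableAt (𝓡 n) (𝓡 n) (chartAt (Euc n) p).symm x :=
    ((contMDiffOn_chart_symm (n := 1) (I := 𝓡 n) (x := p)).contMDiffAt
      (by rw [ht]; exact Filter.univ_mem)).mdifferentiableAt one_ne_zero
  refine (sphereMetric_inner_mfderiv_euc r hr hd _ _).trans ?_
  rw [show (fun q => ((chartAt (Euc n) p).symm q : Euc (n + 1))) = _ from funext hsymm,
    inner_fderiv_stereoParam two_pos (by simp) (fun v => by rw [inner_neg_right, hJ, neg_zero]),
    inner_single_single, confCoeff_apply]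
  ring

end SphereMetric

/-! ### The coordinate metrics. -/

section StereoMetric

variable {m n : ℕ}

theorem stereoMetric_inner (c : ℝ) (hc : 0 < c) (x u v : Euc n) :
    (stereoMetric n c hc).inner x u v = 4 / (c + ‖x‖ ^ 2) ^ 2 * inner ℝ u v := rfl

theorem metricCoeff_stereoMetric (c : ℝ) (hc : 0 < c) (p : Euc n) :
    metricCoeff (stereoMetric n c hc) (chartAt (Euc n) p) = confCoeff n c 4 := by
  funext x
  ext i j
  rw [confCoeff_apply, ← inner_single_single, ← stereoMetric_inner c hc]
  have h : mfderiv (𝓡 n) (𝓡 n) (chartAt (Euc n) p).symm x =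
      ContinuousLinearMap.id ℝ (TangentSpace (𝓡 n) x) := mfderiv_id
  simp only [metricCoeff, h]
  rfl

end StereoMetric

/-! ### The small sphere in `S³`. -/

section SmallSphere

variable (L : Euc 3 →ₗᵢ[ℝ] Euc 4) (a : Euc 4) (ha : ‖a‖ = 1) (hLa : ∀ v, inner ℝ (L v) a = 0)

theorem coe_smallSphere (u : Sph 2) :
    (smallSphere L a ha hLa u : Euc 4) = (1 / √(2 : ℝ)) • (L (u : Euc 3) + a) := rfl

theorem contMDiff_smallSphere : ContMDiff (𝓡 2) (𝓡 3) ∞ (smallSphere L a ha hLa) := by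
  have h2 := fact_finrank_euc 2
  have h3 := fact_finrank_euc 3
  have h : ContDiff ℝ ∞ fun v : Euc 3 => (1 / √(2 : ℝ)) • (L v + a) :=
    (L.toContinuousLinearMap.contDiff.add contDiff_const).const_smul _
  exact (h.contMDiff.comp (contMDiff_coe_sphere (E := Euc 3) (n := 2))).codRestrict_sphere _

theorem smallSphere_injective : Function.Injective (smallSphere L a ha hLa) := by
  intro u v h
  have h' := congrArg Subtype.val h
  rw [coe_smallSphere, coe_smallSphere] at h'
  exact Subtype.ext (L.injective (add_right_cancel
    (smul_right_injective _ inv_sqrt_two_pos.ne' h')))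

/-- The range of `L` and `a^⊥` are both three-dimensional and one contains the other. -/
theorem exists_map_eq_of_inner_eq_zero {w : Euc 4} (ha : ‖a‖ = 1)
    (hLa : ∀ v, inner ℝ (L v) a = 0) (hw : inner ℝ w a = 0) : ∃ v, L v = w := by
  have h0 : a ≠ 0 := fun h => by simp [h] at ha
  have hle : LinearMap.range L.toLinearMap ≤ (ℝ ∙ a)ᗮ := by
    rintro _ ⟨v, rfl⟩
    exact Submodule.mem_orthogonal_singleton_iff_inner_left.2 (hLa v)
  have h1 : Module.finrank ℝ (LinearMap.range L.toLinearMap) = 3 := by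
    rw [LinearMap.finrank_range_of_inj L.injective, finrank_euclideanSpace_fin]
  have := fact_finrank_euc 3
  have h2 : Module.finrank ℝ (ℝ ∙ a)ᗮ = 3 := Submodule.finrank_orthogonal_span_singleton h0
  have h3 := Submodule.eq_of_le_of_finrank_eq hle (h1.trans h2.symm)
  have h4 : w ∈ LinearMap.range L.toLinearMap := by
    rw [h3]
    exact Submodule.mem_orthogonal_singleton_iff_inner_left.2 hw
  exact h4

theorem range_smallSphere : Set.range (smallSphere L a ha hLa) =
    {X : Sph 3 | inner ℝ (X : Euc 4) a = 1 / √(2 : ℝ)} := by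
  have haa : inner ℝ a a = (1 : ℝ) := by rw [real_inner_self_eq_norm_sq, ha, one_pow]
  have hr : √(2 : ℝ) ≠ 0 := by positivity
  have hr2 : √(2 : ℝ) ^ 2 = 2 := Real.sq_sqrt two_pos.le
  ext X
  constructor
  · rintro ⟨u, rfl⟩
    rw [Set.mem_ofPred_eq, coe_smallSphere, inner_smul_left, inner_add_left, hLa, haa]
    simp
  · intro hX
    have hX : inner ℝ (X : Euc 4) a = 1 / √(2 : ℝ) := hX
    obtain ⟨v, hv⟩ := exists_map_eq_of_inner_eq_zero L a (w := √2 • (X : Euc 4) - a) ha hLa (by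
      rw [inner_sub_left, inner_smul_left, hX, haa, conj_trivial, mul_one_div_cancel hr, sub_self])
    have hn : ‖v‖ ^ 2 = 1 := by
      rw [← L.norm_map, hv, norm_sub_sq_real, inner_smul_left, hX, norm_smul, ha,
        norm_eq_of_mem_sphere X, conj_trivial, mul_one_div_cancel hr, mul_one,
        Real.norm_of_nonneg (Real.sqrt_nonneg 2), hr2]
      norm_num
    refine ⟨⟨v, ?_⟩, ?_⟩
    · rw [mem_sphere_zero_iff_norm]
      exact (sq_eq_sq₀ (norm_nonneg _) zero_le_one).1 (by rw [hn, one_pow])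
    · apply Subtype.ext
      rw [coe_smallSphere]
      change (1 / √(2 : ℝ)) • (L v + a) = _
      rw [hv, sub_add_cancel, smul_smul, one_div_mul_cancel hr, one_smul]

theorem isIsometricImmersion_smallSphere :
    IsIsometricImmersion (sphereMetric 2 (1 / √(2 : ℝ)) inv_sqrt_two_pos)
      (sphereMetric 3 1 one_pos) (smallSphere L a ha hLa) := by
  refine ⟨contMDiff_smallSphere L a ha hLa, fun p u v => ?_⟩
  have hd : MDifferentiableAt (𝓡 2) (𝓡 3) (smallSphere L a ha hLa) p :=
    (contMDiff_smallSphere L a ha hLa p).mdifferentiableAt (by simp)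
  have h : HasFDerivAt (fun v : Euc 3 => (1 / √(2 : ℝ)) • (L v + a))
      ((1 / √(2 : ℝ)) • L.toContinuousLinearMap) (p : Euc 3) :=
    (L.toContinuousLinearMap.hasFDerivAt.add_const a).fun_const_smul _
  have e (w : TangentSpace (𝓡 2) p) :
      mvfderiv (𝓡 2) (fun q => (smallSphere L a ha hLa q : Euc 4)) p w =
      (1 / √(2 : ℝ)) • L (mvfderiv (𝓡 2) ((↑) : Sph 2 → Euc 3) p w) := by
    have h' := h.hasMFDerivAt.comp p (mdifferentiableAt_coe_sphere p).hasMFDerivAt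
    exact congrArg (fun A => A w) h'.mfderiv
  refine (sphereMetric_inner_mfderiv 1 one_pos hd u v).trans ?_
  rw [e, e, sphereMetric_inner, inner_smul_left, inner_smul_right, L.inner_map_map, conj_trivial]
  ring

/-- In the preferred charts the small sphere is given by `roundModel`. -/
theorem localRep_smallSphere (p : Sph 2) : ∃ (A : Euc 2 →ₗᵢ[ℝ] Euc 3) (ν : Euc 3), ‖ν‖ = 1 ∧
    (∀ v, inner ℝ (A v) ν = 0) ∧ localRep (smallSphere L a ha hLa) p = roundModel A ν := by
  have haa : inner ℝ a a = (1 : ℝ) := by rw [real_inner_self_eq_norm_sq, ha, one_pow]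
  have haL (v : Euc 3) : inner ℝ a (L v) = 0 := by rw [real_inner_comm, hLa]
  have hr2 : √(2 : ℝ) ^ 2 = 2 := Real.sq_sqrt two_pos.le
  have hr : √(2 : ℝ) ≠ 0 := by positivity
  have hpp : inner ℝ (p : Euc 3) p = (1 : ℝ) := by
    rw [real_inner_self_eq_norm_sq, norm_eq_of_mem_sphere p, one_pow]
  obtain ⟨J, hJ, -, hsymm, -⟩ := exists_chart_formula p
  obtain ⟨K, hK, hKs, -, hchart⟩ := exists_chart_formula (smallSphere L a ha hLa p)
  have hJ' (v : Euc 2) : inner ℝ (p : Euc 3) (J v) = 0 := by rw [real_inner_comm, hJ]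
  have hKq (v : Euc 3) : inner ℝ a (K v) = -inner ℝ (L (p : Euc 3)) (K v) := by
    have h := hK v
    rw [coe_smallSphere, inner_smul_right, inner_add_right, mul_eq_zero] at h
    have h' := h.resolve_left inv_sqrt_two_pos.ne'
    rw [real_inner_comm (L _) (K v), real_inner_comm a (K v)] at h'
    linarith
  -- `L (J x)` is tangent to `S³` at `φ(p)`, hence comes from the chart space through `K`.
  have hA (x : Euc 2) : ∃ v, K v = L (J x) := hKs _ (by
    rw [coe_smallSphere, inner_smul_right, inner_add_right, hLa, L.inner_map_map, hJ]
    simp)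
  have hK' (v : Euc 3) : ContinuousLinearMap.adjoint K.toContinuousLinearMap (K v) = v := by
    refine ext_inner_right ℝ fun w => ?_
    rw [ContinuousLinearMap.adjoint_inner_left]
    exact K.inner_map_map v w
  -- The adjoint of `K` inverts it on its range, so this is the differential `L ∘ J` read through
  -- `K`.
  let A : Euc 2 →ₗᵢ[ℝ] Euc 3 :=
    { toLinearMap := (ContinuousLinearMap.adjoint K.toContinuousLinearMap).toLinearMap ∘ₗ
        L.toLinearMap ∘ₗ J.toLinearMap
      norm_map' := fun x => by
        obtain ⟨v, hv⟩ := hA x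
        change ‖ContinuousLinearMap.adjoint K.toContinuousLinearMap (L (J x))‖ = _
        rw [← hv, hK', ← K.norm_map, hv, L.norm_map, J.norm_map] }
  have hKA (x : Euc 2) : K (A x) = L (J x) := by
    obtain ⟨v, hv⟩ := hA x
    change K (ContinuousLinearMap.adjoint K.toContinuousLinearMap (L (J x))) = _
    rw [← hv, hK']
  -- `(a - L p)/√2` is orthogonal both to `φ(p) = (L p + a)/√2` and to the tangent space of the
  -- small sphere there: it is the unit normal.
  obtain ⟨ν, hν⟩ := hKs ((1 / √(2 : ℝ)) • (a - L (p : Euc 3))) (by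
    rw [coe_smallSphere, inner_smul_right, inner_smul_left, inner_sub_left, inner_add_right,
      inner_add_right, haL, haa, hLa, L.inner_map_map, hpp]
    simp)
  refine ⟨A, ν, ?_, fun v => ?_, ?_⟩
  · have h : ‖ν‖ ^ 2 = 1 := by
      rw [← K.norm_map, hν, norm_smul, mul_pow, norm_sub_sq_real, haL, L.norm_map,
        norm_eq_of_mem_sphere p, ha, Real.norm_of_nonneg inv_sqrt_two_pos.le, div_pow, hr2]
      norm_num
    exact (sq_eq_sq₀ (norm_nonneg _) zero_le_one).1 (by rw [h, one_pow])
  · rw [← K.inner_map_map, hKA, hν, inner_smul_right, inner_sub_right, hLa, L.inner_map_map, hJ]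
    simp
  · funext x
    have h8 : 8 + ‖x‖ ^ 2 ≠ 0 := by positivity
    have h4 : 4 + ‖x‖ ^ 2 ≠ 0 := by positivity
    refine ext_inner_right ℝ fun v => ?_
    have hX : (smallSphere L a ha hLa ((chartAt (Euc 2) p).symm x) : Euc 4) = (1 / √(2 : ℝ)) •
        ((4 + ‖x‖ ^ 2)⁻¹ • ((4 : ℝ) • L (J x) - (‖x‖ ^ 2 - 4) • L (p : Euc 3)) + a) := by
      rw [coe_smallSphere, hsymm, stereoParam]
      simp only [map_smul, map_add, map_neg]
      norm_num [sub_eq_add_neg]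
    -- Positive, so the small sphere avoids the centre of projection `-φ(p)` and the identity holds
    -- on all of the plane.
    have h1 : inner ℝ (smallSphere L a ha hLa p : Euc 4)
        (smallSphere L a ha hLa ((chartAt (Euc 2) p).symm x) : Euc 4) = 4 / (4 + ‖x‖ ^ 2) := by
      rw [hX, coe_smallSphere]
      simp only [inner_smul_left, inner_smul_right, inner_add_left, inner_add_right,
        inner_sub_right, L.inner_map_map, hJ', hpp, haL, hLa, haa, conj_trivial]
      field_simp
      rw [hr2]
      ring
    rw [localRep, hchart, h1, ← K.inner_map_map (roundModel A ν x), roundModel, hX]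
    simp only [map_add, map_smul, hKA, hν, inner_add_left, inner_smul_left, inner_sub_left, hKq,
      conj_trivial]
    rw [show 1 + 4 / (4 + ‖x‖ ^ 2) = (8 + ‖x‖ ^ 2) / (4 + ‖x‖ ^ 2) by field_simp; ring]
    field_simp
    rw [hr2]
    ring

theorem isProperBiharmonicOn_smallSphere {U : Set (Sph 2)} (hU : U.Nonempty) :
    IsProperBiharmonicOn (sphereMetric 2 (1 / √(2 : ℝ)) inv_sqrt_two_pos)
      (sphereMetric 3 1 one_pos) (smallSphere L a ha hLa) U := by
  have h8 : 16 * (1 / √(2 : ℝ)) ^ 2 = 8 := by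
    rw [div_pow, Real.sq_sqrt two_pos.le]
    norm_num
  refine ⟨⟨(contMDiff_smallSphere L a ha hLa).contMDiffOn, fun p _ => ?_⟩, fun h => ?_⟩
  · obtain ⟨A, ν, hν, hA, hloc⟩ := localRep_smallSphere L a ha hLa p
    funext i
    rw [bitension, metricCoeff_sphereMetric, metricCoeff_sphereMetric, hloc, h8, one_pow, mul_one]
    exact (roundModel_tension_bitension hν hA _ i).2
  · obtain ⟨p, hp⟩ := hU
    obtain ⟨A, ν, hν, hA, hloc⟩ := localRep_smallSphere L a ha hLa p
    obtain ⟨J, hJ, -, -, hchart⟩ := exists_chart_formula p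
    -- The chart is centred at `p`, and at the origin the model has `η = ν`; vanishing tension would
    -- force `ν = 0`.
    have hp0 : chartAt (Euc 2) p p = 0 := by
      refine ext_inner_right ℝ fun v => ?_
      rw [hchart, real_inner_comm (J v), hJ, mul_zero, inner_zero_left]
    have h0 := h.2 p hp
    rw [tension, metricCoeff_sphereMetric, metricCoeff_sphereMetric, hloc, h8, one_pow, mul_one,
      hp0] at h0
    have hν0 : ν = 0 := by
      ext i
      have h1 := congrFun h0 i
      rw [(roundModel_tension_bitension hν hA 0 i).1] at h1
      simpa [roundModel] using h1
    simp [hν0] at hν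

end SmallSphere

/-! ### The coordinate map `(x, y) ↦ (x, y, 1)`. -/

section Plane

theorem planeMap_eq_affineModel : ∃ (A : Euc 2 →ₗᵢ[ℝ] Euc 3) (ν : Euc 3), ‖ν‖ = 1 ∧
    (∀ v, inner ℝ (A v) ν = 0) ∧ planeMap = affineModel A ν := by
  let A : Euc 2 →ₗᵢ[ℝ] Euc 3 :=
    { toFun := fun x => !₂[x 0, x 1, 0]
      map_add' := fun x y => by ext i; fin_cases i <;> simp
      map_smul' := fun r x => by ext i; fin_cases i <;> simp
      norm_map' := fun x => by simp [EuclideanSpace.norm_eq, Fin.sum_univ_succ] }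
  refine ⟨A, EuclideanSpace.single 2 1, by simp, fun v => ?_, ?_⟩
  · rw [EuclideanSpace.inner_single_right]
    simp [A]
  · funext x
    ext i
    fin_cases i <;> simp [planeMap, affineModel, A]

theorem contDiff_planeMap : ContDiff ℝ ∞ planeMap := by
  obtain ⟨A, ν, -, -, h⟩ := planeMap_eq_affineModel
  exact h ▸ contDiff_affineModel

theorem isIsometricImmersion_planeMap :
    IsIsometricImmersion (stereoMetric 2 2 two_pos) (stereoMetric 3 1 one_pos) planeMap := by
  refine ⟨contDiff_planeMap.contMDiff, fun x u v => ?_⟩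
  obtain ⟨A, ν, hν, hA, h⟩ := planeMap_eq_affineModel
  have hd : HasFDerivAt planeMap A.toContinuousLinearMap x :=
    h ▸ A.toContinuousLinearMap.hasFDerivAt.add_const ν
  have hm : mfderiv (𝓡 2) (𝓡 3) planeMap x = A.toContinuousLinearMap := hd.hasMFDerivAt.mfderiv
  have hsq : ‖planeMap x‖ ^ 2 = ‖x‖ ^ 2 + 1 := by
    rw [h]
    simpa [affineModel] using norm_sq_combination hν hA 1 1 x
  have key (u v : Euc 2) : (stereoMetric 3 1 one_pos).inner (planeMap x) (A u) (A v) =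
      (stereoMetric 2 2 two_pos).inner x u v := by
    rw [stereoMetric_inner, stereoMetric_inner, hsq, A.inner_map_map,
      show 1 + (‖x‖ ^ 2 + 1) = 2 + ‖x‖ ^ 2 by ring]
  rw [hm]
  exact key u v

theorem isProperBiharmonicOn_planeMap {U : Set (Euc 2)} (hU : U.Nonempty) :
    IsProperBiharmonicOn (stereoMetric 2 2 two_pos) (stereoMetric 3 1 one_pos) planeMap U := by
  obtain ⟨A, ν, hν, hA, h⟩ := planeMap_eq_affineModel
  -- The preferred charts of a Euclidean space are the identity.
  have hloc (p : Euc 2) : localRep planeMap p = affineModel A ν := h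
  refine ⟨⟨contDiff_planeMap.contMDiff.contMDiffOn, fun p _ => ?_⟩, fun hh => ?_⟩
  · funext i
    rw [bitension, metricCoeff_stereoMetric, metricCoeff_stereoMetric, hloc]
    exact (affineModel_tension_bitension hν hA _ i).2
  · obtain ⟨p, hp⟩ := hU
    have h0 := hh.2 p hp
    rw [tension, metricCoeff_stereoMetric, metricCoeff_stereoMetric, hloc] at h0
    have hν0 : ν = 0 := by
      ext i
      have h1 := congrFun h0 i
      rw [(affineModel_tension_bitension hν hA _ i).1] at h1
      have : 2 + ‖chartAt (Euc 2) p p‖ ^ 2 ≠ 0 := by positivity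
      simpa [this] using h1
    simp [hν0] at hν

end Plane

/-! ### Inverse stereographic projection from the north pole. -/

section StereoInv

variable {n : ℕ}

theorem coe_stereoInv : ∃ J : Euc n →ₗᵢ[ℝ] Euc (n + 1),
    (∀ v, inner ℝ (J v) (northPole n : Euc (n + 1)) = 0) ∧
    (fun x => (stereoInv n x : Euc (n + 1))) = stereoParam 1 J (northPole n) := by
  let J : Euc n →ₗᵢ[ℝ] Euc (n + 1) :=
    { toFun := fun x => WithLp.toLp 2 (Fin.snoc (α := fun _ => ℝ) x 0)
      map_add' := fun x y => by
        ext i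
        refine Fin.lastCases ?_ (fun j => ?_) i <;> simp
      map_smul' := fun r x => by
        ext i
        refine Fin.lastCases ?_ (fun j => ?_) i <;> simp
      norm_map' := fun x => by simp [EuclideanSpace.norm_eq, Fin.sum_univ_castSucc] }
  refine ⟨J, fun v => ?_, ?_⟩
  · simp [J, northPole, EuclideanSpace.inner_single_right]
  · funext x
    ext i
    refine Fin.lastCases ?_ (fun j => ?_) i
    · simp [J, stereoInv, stereoParam, northPole]
      ring
    · simp [J, stereoInv, stereoParam, northPole]
      ring

theorem stereoInv_last (x : Euc n) :
    (stereoInv n x : Euc (n + 1)) (Fin.last n) = (‖x‖ ^ 2 - 1) / (1 + ‖x‖ ^ 2) := by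
  simp [stereoInv]

theorem stereoInv_castSucc (x : Euc n) (i : Fin n) :
    (stereoInv n x : Euc (n + 1)) i.castSucc = 2 * x i / (1 + ‖x‖ ^ 2) := by
  simp [stereoInv]

theorem northPole_last : (northPole n : Euc (n + 1)) (Fin.last n) = 1 := by
  simp [northPole]

theorem northPole_castSucc (i : Fin n) : (northPole n : Euc (n + 1)) i.castSucc = 0 := by
  simp [northPole]

theorem stereoInv_injective (n : ℕ) : Function.Injective (stereoInv n) := by
  -- The projection itself, `u ↦ u'/(1 - t)` with `t` the last coordinate; it also supplies the
  -- preimage in `range_stereoInv`.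
  have h (x : Euc n) (i : Fin n) : x i = (stereoInv n x : Euc (n + 1)) i.castSucc /
      (1 - (stereoInv n x : Euc (n + 1)) (Fin.last n)) := by
    have : 1 + ‖x‖ ^ 2 ≠ 0 := by positivity
    rw [stereoInv_last, stereoInv_castSucc, one_sub_div this]
    field_simp
    ring
  intro x y hxy
  ext i
  rw [h x, h y, hxy]

theorem sum_sq_castSucc (u : Sph n) : ∑ i : Fin n, (u : Euc (n + 1)) i.castSucc ^ 2 =
    1 - (u : Euc (n + 1)) (Fin.last n) ^ 2 := by
  have h := EuclideanSpace.real_norm_sq_eq (u : Euc (n + 1))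
  rw [norm_eq_of_mem_sphere, Fin.sum_univ_castSucc] at h
  linarith

theorem range_stereoInv (n : ℕ) : Set.range (stereoInv n) = {northPole n}ᶜ := by
  ext u
  rw [Set.mem_compl_singleton_iff]
  constructor
  · rintro ⟨x, rfl⟩ h
    have h' := congrArg (fun u : Sph n => (u : Euc (n + 1)) (Fin.last n)) h
    simp only [stereoInv_last, northPole_last] at h'
    rw [div_eq_one_iff_eq (by positivity)] at h'
    linarith
  · intro hu
    have hs := sum_sq_castSucc u
    have ht : (u : Euc (n + 1)) (Fin.last n) ≠ 1 := by
      intro ht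
      rw [ht, one_pow, sub_self, Finset.sum_eq_zero_iff_of_nonneg fun _ _ => sq_nonneg _] at hs
      refine hu (Subtype.ext ?_)
      ext i
      refine Fin.lastCases ?_ (fun j => ?_) i
      · rw [ht, northPole_last]
      · rw [northPole_castSucc]
        exact pow_eq_zero_iff two_ne_zero |>.1 (hs j (Finset.mem_univ j))
    set t := (u : Euc (n + 1)) (Fin.last n) with htdef
    have h1 : 1 - t ≠ 0 := sub_ne_zero.2 ht.symm
    have hsq : ‖(WithLp.toLp 2 fun i : Fin n => (u : Euc (n + 1)) i.castSucc / (1 - t) : Euc n)‖ ^ 2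
        = (1 + t) / (1 - t) := by
      rw [EuclideanSpace.real_norm_sq_eq]
      simp only [div_pow, ← Finset.sum_div, hs]
      field_simp
      ring
    refine ⟨WithLp.toLp 2 fun i => (u : Euc (n + 1)) i.castSucc / (1 - t), Subtype.ext ?_⟩
    ext i
    refine Fin.lastCases ?_ (fun j => ?_) i
    · rw [stereoInv_last, hsq, ← htdef, show (1 + t) / (1 - t) - 1 = 2 * t / (1 - t) by
        field_simp; ring, show 1 + (1 + t) / (1 - t) = 2 / (1 - t) by field_simp; ring]
      field_simp
    · rw [stereoInv_castSucc, hsq, show 1 + (1 + t) / (1 - t) = 2 / (1 - t) by field_simp; ring]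
      simp only
      field_simp

theorem contMDiff_stereoInv (n : ℕ) : ContMDiff (𝓡 n) (𝓡 n) ∞ (stereoInv n) := by
  have := fact_finrank_euc n
  obtain ⟨J, -, h⟩ := coe_stereoInv (n := n)
  have h1 : ContDiff ℝ ∞ fun x => (stereoInv n x : Euc (n + 1)) := by
    rw [h]
    exact contDiff_stereoParam one_pos
  exact h1.contMDiff.codRestrict_sphere _

theorem inner_fderiv_stereoInv (x u v : Euc n) :
    inner ℝ (fderiv ℝ (fun y => (stereoInv n y : Euc (n + 1))) x u)
      (fderiv ℝ (fun y => (stereoInv n y : Euc (n + 1))) x v) =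
      4 / (1 + ‖x‖ ^ 2) ^ 2 * inner ℝ u v := by
  obtain ⟨J, hJ, h⟩ := coe_stereoInv (n := n)
  rw [h, inner_fderiv_stereoParam one_pos (by simp) hJ]
  norm_num

theorem differentiable_stereoInv :
    Differentiable ℝ fun x => (stereoInv n x : Euc (n + 1)) := by
  obtain ⟨J, -, h⟩ := coe_stereoInv (n := n)
  rw [h]
  exact (contDiff_stereoParam one_pos).differentiable (by simp)

/-- Radius and dilation each contribute `(1/√2)²`, and `1 + |x|²/2 = (2 + |x|²)/2` turns the factor
into `4/(2+|x|²)²`. -/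
theorem isIsometricImmersion_stereoInv_smul :
    IsIsometricImmersion (stereoMetric n 2 two_pos)
      (sphereMetric n (1 / √(2 : ℝ)) inv_sqrt_two_pos)
      (fun x => stereoInv n ((1 / √(2 : ℝ)) • x)) := by
  have hs : ContMDiff (𝓡 n) (𝓡 n) ∞ fun x => stereoInv n ((1 / √(2 : ℝ)) • x) :=
    (contMDiff_stereoInv n).comp (contDiff_const_smul (𝕜 := ℝ) (1 / √(2 : ℝ))).contMDiff
  refine ⟨hs, fun x u v => ?_⟩
  have hr2 : √(2 : ℝ) ^ 2 = 2 := Real.sq_sqrt two_pos.le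
  have hd : MDifferentiableAt (𝓡 n) (𝓡 n) (fun x => stereoInv n ((1 / √(2 : ℝ)) • x)) x :=
    (hs x).mdifferentiableAt (by simp)
  have hf (w : Euc n) : fderiv ℝ (fun q => (stereoInv n ((1 / √(2 : ℝ)) • q) : Euc (n + 1))) x w =
      (1 / √(2 : ℝ)) • fderiv ℝ (fun q => (stereoInv n q : Euc (n + 1)))
        ((1 / √(2 : ℝ)) • x) w := by
    rw [fderiv_comp_smul (f := fun q => (stereoInv n q : Euc (n + 1)))]
    rfl
  have key (u v : Euc n) : (1 / √(2 : ℝ)) ^ 2 *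
      inner ℝ (fderiv ℝ (fun q => (stereoInv n ((1 / √(2 : ℝ)) • q) : Euc (n + 1))) x u)
        (fderiv ℝ (fun q => (stereoInv n ((1 / √(2 : ℝ)) • q) : Euc (n + 1))) x v) =
      (stereoMetric n 2 two_pos).inner x u v := by
    have h : 2 + ‖x‖ ^ 2 ≠ 0 := by positivity
    rw [hf, hf, inner_smul_left, inner_smul_right, inner_fderiv_stereoInv, stereoMetric_inner,
      norm_smul, mul_pow, Real.norm_of_nonneg inv_sqrt_two_pos.le, div_pow, hr2, conj_trivial,
      show 1 / √(2 : ℝ) * (1 / √(2 : ℝ) * (4 / (1 + 1 ^ 2 / 2 * ‖x‖ ^ 2) ^ 2 * inner ℝ u v)) =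
        (1 / √(2 : ℝ)) ^ 2 * (4 / (1 + 1 ^ 2 / 2 * ‖x‖ ^ 2) ^ 2 * inner ℝ u v) by ring,
      div_pow, hr2, show 1 + 1 ^ 2 / 2 * ‖x‖ ^ 2 = (2 + ‖x‖ ^ 2) / 2 by ring]
    field_simp
  exact (sphereMetric_inner_mfderiv_euc _ inv_sqrt_two_pos hd u v).trans (key u v)

theorem isIsometricImmersion_rotateSphere_stereoInv (T : Euc (n + 1) ≃ₗᵢ[ℝ] Euc (n + 1)) :
    IsIsometricImmersion (stereoMetric n 1 one_pos) (sphereMetric n 1 one_pos)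
      (fun y => rotateSphere T (stereoInv n y)) := by
  have := fact_finrank_euc n
  obtain ⟨J, -, h⟩ := coe_stereoInv (n := n)
  have h1 : ContDiff ℝ ∞ fun x => T (stereoInv n x : Euc (n + 1)) := by
    have h2 : ContDiff ℝ ∞ fun x => (stereoInv n x : Euc (n + 1)) := by
      rw [h]
      exact contDiff_stereoParam one_pos
    exact T.contDiff.comp h2
  have hs : ContMDiff (𝓡 n) (𝓡 n) ∞ fun y => rotateSphere T (stereoInv n y) :=
    h1.contMDiff.codRestrict_sphere _
  refine ⟨hs, fun x u v => ?_⟩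
  have hd : MDifferentiableAt (𝓡 n) (𝓡 n) (fun y => rotateSphere T (stereoInv n y)) x :=
    (hs x).mdifferentiableAt (by simp)
  have hf (w : Euc n) : fderiv ℝ (fun q => (rotateSphere T (stereoInv n q) : Euc (n + 1))) x w =
      T (fderiv ℝ (fun q => (stereoInv n q : Euc (n + 1))) x w) := by
    have h3 := (T.toContinuousLinearEquiv.hasFDerivAt
      (x := (stereoInv n x : Euc (n + 1)))).comp x (differentiable_stereoInv x).hasFDerivAt
    exact congrArg (fun A => A w) h3.fderiv
  have key (u v : Euc n) : (1 : ℝ) ^ 2 *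
      inner ℝ (fderiv ℝ (fun q => (rotateSphere T (stereoInv n q) : Euc (n + 1))) x u)
        (fderiv ℝ (fun q => (rotateSphere T (stereoInv n q) : Euc (n + 1))) x v) =
      (stereoMetric n 1 one_pos).inner x u v := by
    rw [hf, hf, T.inner_map_map, inner_fderiv_stereoInv, stereoMetric_inner, one_pow, one_mul]
  exact (sphereMetric_inner_mfderiv_euc 1 one_pos hd u v).trans (key u v)

theorem rotateSphere_bijective (T : Euc (n + 1) ≃ₗᵢ[ℝ] Euc (n + 1)) :
    Function.Bijective (rotateSphere T) := by
  refine ⟨fun u v h => Subtype.ext (T.injective (congrArg Subtype.val h)), fun u => ?_⟩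
  exact ⟨rotateSphere T.symm u, Subtype.ext (T.apply_symm_apply _)⟩

end StereoInv

/-! ### The rotation that turns the small sphere into the plane `z = 1`. -/

section Coordinates

variable (L : Euc 3 →ₗᵢ[ℝ] Euc 4) (a : Euc 4) (ha : ‖a‖ = 1) (hLa : ∀ v, inner ℝ (L v) a = 0)

/-- The last vector is the image under `φ` of the north pole of `S²`, so `T` matches the two poles.
As `a` is the sum of the last two vectors divided by `√2`, the small sphere becomes `y₂ + y₃ = 1`,
which in stereographic coordinates is `z = 1`. -/
theorem exists_rotation_smallSphere (ha : ‖a‖ = 1) (hLa : ∀ v, inner ℝ (L v) a = 0) :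
    ∃ T : Euc 4 ≃ₗᵢ[ℝ] Euc 4, ∀ y : Euc 4, T y =
      y 0 • L (EuclideanSpace.single 0 1) + y 1 • L (EuclideanSpace.single 1 1) +
      y 2 • (1 / √(2 : ℝ)) • (a - L (EuclideanSpace.single 2 1)) +
      y 3 • (1 / √(2 : ℝ)) • (a + L (EuclideanSpace.single 2 1)) := by
  have haL (v : Euc 3) : inner ℝ a (L v) = 0 := by rw [real_inner_comm, hLa]
  have hnorm (s : ℝ) (hs : s ^ 2 = 1) :
      ‖(1 / √(2 : ℝ)) • (a + s • L (EuclideanSpace.single 2 1))‖ = 1 := by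
    refine (sq_eq_sq₀ (norm_nonneg _) zero_le_one).1 ?_
    rw [norm_smul, mul_pow, norm_add_sq_real, inner_smul_right, haL, norm_smul, L.norm_map, ha,
      Real.norm_of_nonneg inv_sqrt_two_pos.le, div_pow, Real.sq_sqrt two_pos.le, mul_pow,
      Real.norm_eq_abs, sq_abs, hs]
    norm_num
  let w : Fin 4 → Euc 4 := ![L (EuclideanSpace.single 0 1), L (EuclideanSpace.single 1 1),
    (1 / √(2 : ℝ)) • (a - L (EuclideanSpace.single 2 1)),
    (1 / √(2 : ℝ)) • (a + L (EuclideanSpace.single 2 1))]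
  have hw : Orthonormal ℝ w := by
    constructor
    · intro i
      fin_cases i
      · simp [w]
      · simp [w]
      · simpa [w, ← sub_eq_add_neg] using hnorm (-1) (by norm_num)
      · simpa [w] using hnorm 1 (by norm_num)
    · intro i j hij
      fin_cases i <;> fin_cases j <;>
        simp [w, inner_smul_left, inner_smul_right, inner_add_left, inner_add_right,
          inner_sub_left, inner_sub_right, L.inner_map_map, ha, haL, hLa, inner_single_single,
          kron] at hij ⊢
  -- Four orthonormal vectors span `ℝ⁴`; `T` is the inverse of the coordinate map of this basis.
  let B : OrthonormalBasis (Fin 4) ℝ (Euc 4) := OrthonormalBasis.mk hw (by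
    rw [hw.linearIndependent.span_eq_top_of_card_eq_finrank' (by simp)])
  refine ⟨B.repr.symm, fun y => ?_⟩
  have h := B.sum_repr_symm y
  rw [← h]
  simp [B, w, Fin.sum_univ_succ, add_assoc]

theorem smallSphere_stereoInv {T : Euc 4 ≃ₗᵢ[ℝ] Euc 4} (hT : ∀ y : Euc 4, T y =
      y 0 • L (EuclideanSpace.single 0 1) + y 1 • L (EuclideanSpace.single 1 1) +
      y 2 • (1 / √(2 : ℝ)) • (a - L (EuclideanSpace.single 2 1)) +
      y 3 • (1 / √(2 : ℝ)) • (a + L (EuclideanSpace.single 2 1))) (x : Euc 2) :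
    smallSphere L a ha hLa (stereoInv 2 ((1 / √(2 : ℝ)) • x)) =
      rotateSphere T (stereoInv 3 (planeMap x)) := by
  have hr2 : √(2 : ℝ) ^ 2 = 2 := Real.sq_sqrt two_pos.le
  have h : 2 + ‖x‖ ^ 2 ≠ 0 := by positivity
  have hp : ‖planeMap x‖ ^ 2 = ‖x‖ ^ 2 + 1 := by
    simp [planeMap, EuclideanSpace.real_norm_sq_eq, Fin.sum_univ_succ]
    ring
  have hn : ‖(1 / √(2 : ℝ)) • x‖ ^ 2 = ‖x‖ ^ 2 / 2 := by
    rw [norm_smul, mul_pow, Real.norm_of_nonneg inv_sqrt_two_pos.le, div_pow, hr2]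
    ring
  have hL (v : Euc 3) : L v = v 0 • L (EuclideanSpace.single 0 1) +
      v 1 • L (EuclideanSpace.single 1 1) + v 2 • L (EuclideanSpace.single 2 1) := by
    conv_lhs => rw [← (EuclideanSpace.basisFun (Fin 3) ℝ).sum_repr v]
    simp [Fin.sum_univ_succ, add_assoc]
  have c0 := stereoInv_castSucc ((1 / √(2 : ℝ)) • x) 0
  have c1 := stereoInv_castSucc ((1 / √(2 : ℝ)) • x) 1
  have c2 := stereoInv_last ((1 / √(2 : ℝ)) • x)
  have d0 := stereoInv_castSucc (planeMap x) 0
  have d1 := stereoInv_castSucc (planeMap x) 1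
  have d2 := stereoInv_castSucc (planeMap x) 2
  have d3 := stereoInv_last (planeMap x)
  rw [hn] at c0 c1 c2
  rw [hp] at d0 d1 d2 d3
  have e0 : planeMap x 0 = x 0 := rfl
  have e1 : planeMap x 1 = x 1 := rfl
  have e2 : planeMap x 2 = 1 := rfl
  rw [e0] at d0
  rw [e1] at d1
  rw [e2] at d2
  change (stereoInv 2 ((1 / √(2 : ℝ)) • x) : Euc 3) 0 = _ at c0
  change (stereoInv 2 ((1 / √(2 : ℝ)) • x) : Euc 3) 1 = _ at c1
  change (stereoInv 2 ((1 / √(2 : ℝ)) • x) : Euc 3) 2 = _ at c2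
  change (stereoInv 3 (planeMap x) : Euc 4) 0 = _ at d0
  change (stereoInv 3 (planeMap x) : Euc 4) 1 = _ at d1
  change (stereoInv 3 (planeMap x) : Euc 4) 2 = _ at d2
  change (stereoInv 3 (planeMap x) : Euc 4) 3 = _ at d3
  apply Subtype.ext
  change (1 / √(2 : ℝ)) • (L (stereoInv 2 ((1 / √(2 : ℝ)) • x) : Euc 3) + a) =
    T (stereoInv 3 (planeMap x) : Euc 4)
  rw [hL, hT, c0, c1, c2, d0, d1, d2, d3, PiLp.smul_apply, PiLp.smul_apply, smul_eq_mul,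
    smul_eq_mul, show 1 + ‖x‖ ^ 2 / 2 = (2 + ‖x‖ ^ 2) / 2 by ring,
    show 1 + (‖x‖ ^ 2 + 1) = 2 + ‖x‖ ^ 2 by ring]
  -- The coefficients of `L e₀`, `L e₁`, `L e₂` and `a` are compared separately.
  match_scalars
  · field_simp
    rw [hr2]
  · field_simp
    rw [hr2]
  · field_simp
    ring
  · field_simp
    ring

end Coordinates

end

theorem mainTheorem7 (L : Euc 3 →ₗᵢ[ℝ] Euc 4) (a : Euc 4) (ha : ‖a‖ = 1)
    (hLa : ∀ v, inner ℝ (L v) a = 0) :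
    -- `φ` is an isometric embedding of `S²(1/√2)` onto the small sphere `⟪X, a⟫ = 1/√2` of `S³`
    (IsIsometricImmersion (sphereMetric 2 (1 / √(2 : ℝ)) inv_sqrt_two_pos)
        (sphereMetric 3 1 one_pos) (smallSphere L a ha hLa) ∧
      Function.Injective (smallSphere L a ha hLa) ∧
      Set.range (smallSphere L a ha hLa) =
        {X : Sph 3 | inner ℝ (X : Euc 4) a = 1 / √(2 : ℝ)}) ∧
    -- the whole sphere and each of its nonempty open parts is proper biharmonic
    (∀ U : Set (Sph 2), IsOpen U → U.Nonempty →
      IsProperBiharmonicOn (sphereMetric 2 (1 / √(2 : ℝ)) inv_sqrt_two_pos)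
        (sphereMetric 3 1 one_pos) (smallSphere L a ha hLa) U) ∧
    -- in stereographic coordinates of the two spheres, `φ` is `(x, y) ↦ (x, y, 1)`
    (∃ T : Euc 4 ≃ₗᵢ[ℝ] Euc 4,
      (IsIsometricImmersion (stereoMetric 2 2 two_pos)
          (sphereMetric 2 (1 / √(2 : ℝ)) inv_sqrt_two_pos)
          (fun x => stereoInv 2 ((1 / √(2 : ℝ)) • x)) ∧
        Function.Injective (fun x => stereoInv 2 ((1 / √(2 : ℝ)) • x)) ∧
        Set.range (fun x => stereoInv 2 ((1 / √(2 : ℝ)) • x)) = {northPole 2}ᶜ) ∧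
      (IsIsometricImmersion (stereoMetric 3 1 one_pos) (sphereMetric 3 1 one_pos)
          (fun y => rotateSphere T (stereoInv 3 y)) ∧
        Function.Injective (fun y => rotateSphere T (stereoInv 3 y)) ∧
        Set.range (fun y => rotateSphere T (stereoInv 3 y)) =
          {rotateSphere T (northPole 3)}ᶜ) ∧
      ∀ x : Euc 2, smallSphere L a ha hLa (stereoInv 2 ((1 / √(2 : ℝ)) • x)) =
        rotateSphere T (stereoInv 3 (planeMap x))) ∧
    -- the coordinate map is an isometric immersion and proper biharmonic
    IsIsometricImmersion (stereoMetric 2 2 two_pos) (stereoMetric 3 1 one_pos) planeMap ∧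
    ∀ U : Set (Euc 2), IsOpen U → U.Nonempty →
      IsProperBiharmonicOn (stereoMetric 2 2 two_pos) (stereoMetric 3 1 one_pos) planeMap U := by
  obtain ⟨T, hT⟩ := exists_rotation_smallSphere L a ha hLa
  refine ⟨⟨isIsometricImmersion_smallSphere L a ha hLa, smallSphere_injective L a ha hLa,
    range_smallSphere L a ha hLa⟩, fun U _ hU => isProperBiharmonicOn_smallSphere L a ha hLa hU,
    ⟨T, ⟨isIsometricImmersion_stereoInv_smul, ?_, ?_⟩,
      ⟨isIsometricImmersion_rotateSphere_stereoInv T, ?_, ?_⟩,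
      fun x => smallSphere_stereoInv L a ha hLa hT x⟩,
    isIsometricImmersion_planeMap, fun U _ hU => isProperBiharmonicOn_planeMap hU⟩
  · exact (stereoInv_injective 2).comp (smul_right_injective _ inv_sqrt_two_pos.ne')
  · have hsurj : Function.Surjective fun x : Euc 2 => (1 / √(2 : ℝ)) • x := fun x =>
      ⟨(1 / √(2 : ℝ))⁻¹ • x, smul_inv_smul₀ inv_sqrt_two_pos.ne' x⟩
    exact (hsurj.range_comp (stereoInv 2)).trans (range_stereoInv 2)
  · exact (rotateSphere_bijective T).1.comp (stereoInv_injective 3)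
  · refine (Set.range_comp (rotateSphere T) (stereoInv 3)).trans ?_
    rw [range_stereoInv, Set.image_compl_eq (rotateSphere_bijective T), Set.image_singleton]
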